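/- Conventions. $\log$ is to base $2$, $H(p)=p\log\frac1p+(1-p)\log\frac1{1-p}$ is the binary entropy, and $U_m$ is the uniform distribution on $\{0,1\}^m$. The min-entropy of a distribution $X$ is $\min_x\log(1/\Pr[X=x])$, and statistical distance is half the $\ell_1$ distance. Output $j$ of $h:\{0,1\}^n\to\{0,1\}^m$ depends on input $i$ if there are $x,x'$ differing only in coordinate $i$ with $h(x)_j\ne h(x')_j$; $h$ is $s$-sparse if there are at most $s$ pairs $(i,j)$ such that output $j$ depends on input $i$. For $p\in[0,1]$, the truncated $p$-biased distribution $\overline X_p$ on $\{0,1\}^n$ is obtained by sampling $x$ with independent coordinates, each equal to $1$ with probability $p$, and outputting $x$ if its Hamming weight is at least $0.9pn$ and a fresh uniformly random string otherwise. Theorem. There are absolute constants $c>0$ and $m_0$ such that the following holds for all integers $n$ and $m\ge m_0$ with $n^{0.99}\le m\le n/6$. Put $s=0.001\,n\log m\,\log(2n/m)$. (a) There is a $p\in[0,1/2]$ with $H(p)=2m/n$ such that the distribution $\mathcal D$ over distributions on $\{0,1\}^n$ which picks $y\in\{0,1\}^n$ uniformly at random and outputs the distribution of $y+\overline X_p$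 (addition modulo 2 in each coordinate) has the following properties: every $\overline X$ in the support of $\mathcal D$ has min-entropy at least $1.5m$, and for every $s$-sparse $h:\{0,1\}^n\to\{0,1\}^m$, $$\mathbb E_{\overline X\sim\mathcal D}\bigl[\text{statistical distance between } h(\overline X)\text{ and } U_m\bigr]\ \ge\ 1-e^{-m^{c}}.$$ (b) Consequently, let $F$ be a distribution on functions $\{0,1\}^n\to\{0,1\}^m$ that is a strong extractor family for min-entropy $1.5m$ with error $\varepsilon$, i.e. for every distribution $X$ on $\{0,1\}^n$ of min-entropy at least $1.5m$ the statistical distance between $(h,h(X))$ and $(h,U_m)$, where $h\sim F$ is independent of $X$ and $U_m$, is at most $\varepsilon$. Then $$\Pr_{h\sim F}[h\text{ is } s\text{-sparse}]\cdot\bigl(1-e^{-m^{c}}\bigr)\ \le\ \varepsilon .$$ So a strong extractor family with constant error $\varepsilon<1$ cannot, for large $m$, consist of functions of sparsity at most $0.001\,n\log m\,\log(2n/m)$. -/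

import Mathlib

namespace SparseExtractor

/-- Bit strings of length `n`. -/
abbrev Bits (n : ℕ) : Type := Fin n → Bool

/-- Output `j` of `h` depends on input `i`: two assignments that agree outside coordinate `i`
are mapped to strings with different `j`-th bits (so they do differ in coordinate `i`). -/
def DependsOn {n m : ℕ} (h : Bits n → Bits m) (i : Fin n) (j : Fin m) : Prop :=
  ∃ x x' : Bits n, (∀ k, k ≠ i → x k = x' k) ∧ h x j ≠ h x' j

/-- The number of input-output pairs `(i, j)` such that output `j` depends on input `i`. -/
noncomputable def sparsity {n m : ℕ} (h : Bits n → Bits m) : ℕ :=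
  Set.ncard {q : Fin n × Fin m | DependsOn h q.1 q.2}

/-- `h` is `s`-sparse. -/
def IsSparse {n m : ℕ} (s : ℝ) (h : Bits n → Bits m) : Prop :=
  (sparsity h : ℝ) ≤ s

/-- Min-entropy in bits, `min_x log₂ (1 / P(x))`, of a distribution on a finite set. -/
noncomputable def minEntropy {α : Type} [Fintype α] (P : PMF α) : ℝ :=
  -Real.logb 2 (⨆ x, (P x).toReal)

/-- Statistical (total variation) distance of two distributions on a finite set. -/
noncomputable def statDist {α : Type} [Fintype α] (P Q : PMF α) : ℝ :=
  (1 / 2) * ∑ x, |(P x).toReal - (Q x).toReal|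

/-- Expectation of a real function under a discrete distribution. -/
noncomputable def expectation {α : Type} (P : PMF α) (f : α → ℝ) : ℝ :=
  ∑' x, (P x).toReal * f x

/-- The uniform distribution on bit strings of length `n`. -/
noncomputable def uniform (n : ℕ) : PMF (Bits n) := PMF.uniformOfFintype (Bits n)

/-- The binary entropy function with logarithms to base 2. -/
noncomputable def binaryEntropy (p : ℝ) : ℝ := Real.binEntropy p / Real.log 2

/-- Hamming weight. -/
def weight {n : ℕ} (x : Bits n) : ℕ := (Finset.univ.filter fun i => x i = true).card

/-- Coordinatewise addition modulo 2. -/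
def add {n : ℕ} (y x : Bits n) : Bits n := fun i => xor (y i) (x i)

theorem sum_biased (n : ℕ) (p : unitInterval) :
    ∑ x : Bits n, ENNReal.ofReal (∏ i, if x i = true then (p : ℝ) else 1 - p) = 1 := by
  have h0 : ∀ b : Bool, 0 ≤ if b = true then (p : ℝ) else 1 - p := by
    intro b
    have h1 := p.2.1
    have h2 := p.2.2
    split <;> linarith
  rw [← ENNReal.ofReal_sum_of_nonneg fun x _ => Finset.prod_nonneg fun i _ => h0 (x i)]
  have key := Finset.prod_univ_sum (fun _ : Fin n => (Finset.univ : Finset Bool))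
    (fun _ b => if b = true then (p : ℝ) else 1 - p)
  rw [Fintype.piFinset_univ] at key
  rw [← key]
  simp

/-- The `p`-biased distribution on `{0,1}^n`: each bit is 1 independently with probability `p`. -/
noncomputable def biased (n : ℕ) (p : unitInterval) : PMF (Bits n) :=
  PMF.ofFintype (fun x => ENNReal.ofReal (∏ i, if x i = true then (p : ℝ) else 1 - p))
    (sum_biased n p)

/-- The truncated `p`-biased distribution: sample `x` from the `p`-biased distribution; output `x`
if its Hamming weight is at least `0.9 p n`, and a fresh uniformly random string otherwise. -/
noncomputable def truncatedBiased (n : ℕ) (p : unitInterval) : PMF (Bits n) :=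
  (biased n p).bind fun x =>
    if 0.9 * (p : ℝ) * n ≤ weight x then PMF.pure x else uniform n

/-- The distribution of `y + X` for `X` drawn from `P`. -/
noncomputable def shift {n : ℕ} (y : Bits n) (P : PMF (Bits n)) : PMF (Bits n) :=
  P.map (add y)

/-- The distribution over distributions: choose `y` uniformly at random and output the truncated
`p`-biased distribution shifted by `y`. -/
noncomputable def shiftedTruncatedBiased (n : ℕ) (p : unitInterval) : PMF (PMF (Bits n)) :=
  (uniform n).map fun y => shift y (truncatedBiased n p)

/-- `F`, a distribution on functions, is a strong extractor family for min-entropy `k` with error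
`ε`: for each source `X` of min-entropy at least `k`, the pairs `(H, H(X))` and `(H, U_m)`, with
`H` drawn from `F` independently of `X` and `U_m`, are at statistical distance at most `ε`. -/
def IsStrongExtractorFamily {n m : ℕ} (k ε : ℝ) (F : PMF (Bits n → Bits m)) : Prop :=
  (m : ℝ) ≤ k ∧ ∀ X : PMF (Bits n), k ≤ minEntropy X →
    statDist (F.bind fun h => X.map fun x => (h, h x))
      (F.bind fun h => (uniform m).map fun u => (h, u)) ≤ ε

end SparseExtractor

/-! Let `y` be uniform and let `v` be `y` plus `p`-biased noise. An output bit that reads `d` inputs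
keeps correlation at least `(1-2p)^d` between `h y` and `h v` (`prod_le_noiseCorrelation_self`).
Sparsity bounds the mean of `d` by `s/m`, and `H(p) = 2m/n` forces `p n log(2n/m) = O(m)`
(`bias_mul_le`). By convexity `h y` and `h v` then agree on average in at least `m/2 + m^0.98/2`
places, whereas a uniform string agrees with a fixed one in `m/2 + O(√m)` places. Knowledge of `y`
therefore yields a test separating `h v` from uniform.

The agreement must exceed its threshold with overwhelming probability. McDiarmid's inequality gives
this only if the squared in-degrees have a small sum, which a few influential inputs can spoil. The
set `H` of inputs of in-degree above `D = √m` has at most `s/D` elements. Fixing them to the values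
they have in `v`, in both arguments of `h`, leaves a sum of squares of at most `D s`. The test does
not know `v` on `H`, so it tries all assignments there (`testSet`). The union bound costs a factor
`2^(s/D)` with `s/D ≤ m^0.54`, negligible against the tail `exp(-Ω(m^0.96))`.
`one_sub_le_expectation_statDist` collects these errors.

Truncation adds only the probability of low weight to the error. It secures the min-entropy, since a
string of weight at least `0.9pn` has biased probability at most `2^(-0.9 n H(p)) = 2^(-1.8m)`. Part
(b) exchanges the average over `y` with the average over `h`. -/

namespace SparseExtractor

/-! ### Hoeffding's lemma and McDiarmid's inequality on finite product spaces. -/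

section Concentration

variable {A : Type}

/-- The weight of a point under a product of weights on the coordinates. -/
noncomputable def productWeight {n : ℕ} (w : Fin n → A → ℝ) (x : Fin n → A) : ℝ :=
  ∏ i, w i (x i)

/-- `f` changes by at most `c i` when only coordinate `i` is changed. -/
def BoundedDifferences {n : ℕ} (c : Fin n → ℝ) (f : (Fin n → A) → ℝ) : Prop :=
  ∀ i x x', (∀ k, k ≠ i → x k = x' k) → |f x - f x'| ≤ c i

theorem productWeight_nonneg {n : ℕ} {w : Fin n → A → ℝ} (hw : ∀ i a, 0 ≤ w i a)
    (x : Fin n → A) : 0 ≤ productWeight w x :=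
  Finset.prod_nonneg fun i _ => hw i (x i)

theorem productWeight_cons {n : ℕ} (w : Fin (n + 1) → A → ℝ) (a : A) (x : Fin n → A) :
    productWeight w (Fin.cons a x : Fin (n + 1) → A)
      = w 0 a * productWeight (fun i => w i.succ) x := by
  simp [productWeight, Fin.prod_univ_succ]

variable [Fintype A]

theorem sum_fin_succ {n : ℕ} (f : (Fin (n + 1) → A) → ℝ) :
    ∑ x, f x = ∑ a, ∑ x, f (Fin.cons a x) := by
  rw [← (Fin.consEquiv fun _ : Fin (n + 1) => A).sum_comp, Fintype.sum_prod_type]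
  rfl

theorem sum_productWeight {n : ℕ} {w : Fin n → A → ℝ} (hw : ∀ i, ∑ a, w i a = 1) :
    ∑ x, productWeight w x = 1 := by
  classical
  have key := Finset.prod_univ_sum (fun _ : Fin n => (Finset.univ : Finset A)) w
  rw [Fintype.piFinset_univ] at key
  simp only [productWeight]
  rw [← key]
  simp [hw]

/-- Hoeffding's lemma for a finite distribution, with a crude constant. -/
theorem hoeffding_finite {w : A → ℝ} (hw : ∀ a, 0 ≤ w a) (hw1 : ∑ a, w a = 1) {f : A → ℝ}
    {c : ℝ} (hf : ∀ a b, |f a - f b| ≤ c) :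
    ∑ a, w a * Real.exp (f a) ≤ Real.exp (∑ a, w a * f a + c ^ 2 / 2) := by
  set μ := ∑ a, w a * f a with hμ
  have hdev : ∀ a, |f a - μ| ≤ c := by
    intro a
    have h1 : f a - μ = ∑ b, w b * (f a - f b) := by
      simp only [mul_sub, Finset.sum_sub_distrib, ← Finset.sum_mul, hw1, one_mul, hμ]
    rw [h1]
    calc |∑ b, w b * (f a - f b)| ≤ ∑ b, |w b * (f a - f b)| := Finset.abs_sum_le_sum_abs _ _
      _ ≤ ∑ b, w b * c := by
          refine Finset.sum_le_sum fun b _ => ?_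
          rw [abs_mul, abs_of_nonneg (hw b)]
          exact mul_le_mul_of_nonneg_left (hf a b) (hw b)
      _ = c := by rw [← Finset.sum_mul, hw1, one_mul]
  have hc : 0 ≤ c := by
    by_contra hneg
    have hA : IsEmpty A := ⟨fun a => hneg ((abs_nonneg _).trans (hf a a))⟩
    simp at hw1
  -- On `[-c, c]` the exponential lies below its chord. The linear term has mean zero, which leaves
  -- `cosh c ≤ exp (c ^ 2 / 2)`. For `c = 0` all deviations vanish, so the value of `sinh c / c` is
  -- irrelevant.
  have hpt : ∀ a, Real.exp (f a - μ) ≤ Real.cosh c + (f a - μ) * (Real.sinh c / c) := by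
    intro a
    rcases hc.eq_or_lt with h0 | hpos
    · have := hdev a
      rw [← h0] at this ⊢
      rw [abs_nonpos_iff.1 this]
      simp
    · have h2 := abs_le.1 (hdev a)
      have hconv := convexOn_exp.2 (Set.mem_univ c) (Set.mem_univ (-c))
        (div_nonneg (by linarith) (by linarith) : 0 ≤ (c + (f a - μ)) / (2 * c))
        (div_nonneg (by linarith) (by linarith) : 0 ≤ (c - (f a - μ)) / (2 * c))
        (by field_simp; ring)
      simp only [smul_eq_mul] at hconv
      have e1 : (c + (f a - μ)) / (2 * c) * c + (c - (f a - μ)) / (2 * c) * -c = f a - μ := by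
        field_simp; ring
      rw [e1] at hconv
      refine hconv.trans (le_of_eq ?_)
      rw [Real.cosh_eq, Real.sinh_eq]
      field_simp
      ring
  have hsum : ∑ a, w a * Real.exp (f a - μ) ≤ Real.cosh c := by
    calc ∑ a, w a * Real.exp (f a - μ)
        ≤ ∑ a, w a * (Real.cosh c + (f a - μ) * (Real.sinh c / c)) :=
          Finset.sum_le_sum fun a _ => mul_le_mul_of_nonneg_left (hpt a) (hw a)
      _ = ∑ a, (w a * Real.cosh c + (w a * f a - w a * μ) * (Real.sinh c / c)) :=
          Finset.sum_congr rfl fun a _ => by ring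
      _ = Real.cosh c := by
          rw [Finset.sum_add_distrib, ← Finset.sum_mul, ← Finset.sum_mul,
            Finset.sum_sub_distrib, ← Finset.sum_mul, hw1, ← hμ]
          ring
  calc ∑ a, w a * Real.exp (f a) = Real.exp μ * ∑ a, w a * Real.exp (f a - μ) := by
        rw [Finset.mul_sum]
        refine Finset.sum_congr rfl fun a _ => ?_
        rw [mul_left_comm, ← Real.exp_add]
        congr 2
        ring
    _ ≤ Real.exp μ * Real.exp (c ^ 2 / 2) :=
        mul_le_mul_of_nonneg_left (hsum.trans (Real.cosh_le_exp_half_sq c)) (Real.exp_pos _).le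
    _ = _ := (Real.exp_add _ _).symm

/-- The exponential moment bound behind McDiarmid's inequality. -/
theorem sum_productWeight_mul_exp_le {n : ℕ} {w : Fin n → A → ℝ} (hw : ∀ i a, 0 ≤ w i a)
    (hw1 : ∀ i, ∑ a, w i a = 1) {c : Fin n → ℝ} {f : (Fin n → A) → ℝ}
    (hf : BoundedDifferences c f) :
    ∑ x, productWeight w x * Real.exp (f x)
      ≤ Real.exp (∑ x, productWeight w x * f x + (∑ i, c i ^ 2) / 2) := by
  induction n with
  | zero => simp [productWeight]
  | succ n ih =>
    set w' : Fin n → A → ℝ := fun i => w i.succ with hw'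
    -- Averaging out coordinate `0` preserves the mean and the other difference bounds. Hoeffding's
    -- lemma, with the remaining coordinates held fixed, pays `c 0 ^ 2 / 2` for it.
    set g : (Fin n → A) → ℝ := fun x => ∑ a, w 0 a * f (Fin.cons a x) with hg
    have hgb : BoundedDifferences (fun i => c i.succ) g := by
      intro i x x' hxx
      rw [hg]
      simp only
      rw [← Finset.sum_sub_distrib]
      calc |∑ a, (w 0 a * f (Fin.cons a x) - w 0 a * f (Fin.cons a x'))|
          ≤ ∑ a, |w 0 a * f (Fin.cons a x) - w 0 a * f (Fin.cons a x')| :=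
            Finset.abs_sum_le_sum_abs _ _
        _ ≤ ∑ a, w 0 a * c i.succ := by
            refine Finset.sum_le_sum fun a _ => ?_
            rw [← mul_sub, abs_mul, abs_of_nonneg (hw 0 a)]
            refine mul_le_mul_of_nonneg_left (hf i.succ _ _ fun k hk => ?_) (hw 0 a)
            refine Fin.cases ?_ (fun k hk => ?_) k hk
            · intro _; rfl
            · simpa using hxx k fun h => hk (by rw [h])
        _ = c i.succ := by rw [← Finset.sum_mul, hw1, one_mul]
    have hin : ∀ x : Fin n → A, ∑ a, w 0 a * Real.exp (f (Fin.cons a x))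
        ≤ Real.exp (g x + c 0 ^ 2 / 2) := by
      intro x
      refine hoeffding_finite (hw 0) (hw1 0) fun a b => hf 0 _ _ fun k hk => ?_
      obtain ⟨j, rfl⟩ := Fin.exists_succ_eq.2 hk
      rfl
    have hmean : ∑ x, productWeight w x * f x = ∑ x, productWeight w' x * g x := by
      rw [sum_fin_succ, Finset.sum_comm]
      refine Finset.sum_congr rfl fun x _ => ?_
      rw [hg, Finset.mul_sum]
      refine Finset.sum_congr rfl fun a _ => ?_
      rw [productWeight_cons]
      ring
    rw [hmean, sum_fin_succ, Finset.sum_comm]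
    calc ∑ x, ∑ a, productWeight w (Fin.cons a x : Fin (n + 1) → A) * Real.exp (f (Fin.cons a x))
        = ∑ x, productWeight w' x * ∑ a, w 0 a * Real.exp (f (Fin.cons a x)) := by
          refine Finset.sum_congr rfl fun x _ => ?_
          rw [Finset.mul_sum]
          refine Finset.sum_congr rfl fun a _ => ?_
          rw [productWeight_cons]
          ring
      _ ≤ ∑ x, productWeight w' x * Real.exp (g x + c 0 ^ 2 / 2) :=
          Finset.sum_le_sum fun x _ => mul_le_mul_of_nonneg_left (hin x)
            (productWeight_nonneg (fun i => hw i.succ) x)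
      _ = (∑ x, productWeight w' x * Real.exp (g x)) * Real.exp (c 0 ^ 2 / 2) := by
          rw [Finset.sum_mul]
          refine Finset.sum_congr rfl fun x _ => ?_
          rw [Real.exp_add]
          ring
      _ ≤ Real.exp (∑ x, productWeight w' x * g x + (∑ i : Fin n, c i.succ ^ 2) / 2)
            * Real.exp (c 0 ^ 2 / 2) :=
          mul_le_mul_of_nonneg_right
            (ih (fun i => hw i.succ) (fun i => hw1 i.succ) hgb) (Real.exp_pos _).le
      _ = _ := by
          rw [← Real.exp_add, Fin.sum_univ_succ]
          congr 1
          ring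

open Classical in
/-- McDiarmid's inequality, lower tail. -/
theorem mcdiarmid_lower {n : ℕ} {w : Fin n → A → ℝ} (hw : ∀ i a, 0 ≤ w i a)
    (hw1 : ∀ i, ∑ a, w i a = 1) {c : Fin n → ℝ} {f : (Fin n → A) → ℝ}
    (hf : BoundedDifferences c f) {C t : ℝ} (hC : 0 < C) (hcC : ∑ i, c i ^ 2 ≤ C) (ht : 0 ≤ t) :
    ∑ x, productWeight w x * (if f x ≤ ∑ x, productWeight w x * f x - t then 1 else 0)
      ≤ Real.exp (-(t ^ 2 / (2 * C))) := by
  set μ := ∑ x, productWeight w x * f x with hμ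
  -- This is the minimiser of the exponent `-l * t + l ^ 2 * C / 2`.
  set l := t / C with hl
  have hl0 : 0 ≤ l := by positivity
  have hfb : BoundedDifferences (fun i => l * c i) fun x => -l * f x := by
    intro i x x' h
    rw [← mul_sub, abs_mul, abs_neg, abs_of_nonneg hl0]
    exact mul_le_mul_of_nonneg_left (hf i x x' h) hl0
  have hm := sum_productWeight_mul_exp_le hw hw1 hfb
  have e1 : ∑ x, productWeight w x * (-l * f x) = -l * μ := by
    rw [hμ, Finset.mul_sum]
    exact Finset.sum_congr rfl fun x _ => by ring
  have e2 : ∑ i, (l * c i) ^ 2 = l ^ 2 * ∑ i, c i ^ 2 := by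
    rw [Finset.mul_sum]
    exact Finset.sum_congr rfl fun x _ => by ring
  rw [e1, e2] at hm
  calc ∑ x, productWeight w x * (if f x ≤ μ - t then 1 else 0)
      ≤ ∑ x, productWeight w x * (Real.exp (-l * f x) * Real.exp (l * (μ - t))) := by
        refine Finset.sum_le_sum fun x _ =>
          mul_le_mul_of_nonneg_left ?_ (productWeight_nonneg hw x)
        rw [← Real.exp_add]
        split_ifs with h
        · refine Real.one_le_exp ?_
          nlinarith
        · exact (Real.exp_pos _).le
    _ = (∑ x, productWeight w x * Real.exp (-l * f x)) * Real.exp (l * (μ - t)) := by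
        rw [Finset.sum_mul]
        exact Finset.sum_congr rfl fun x _ => by ring
    _ ≤ Real.exp (-l * μ + l ^ 2 * (∑ i, c i ^ 2) / 2) * Real.exp (l * (μ - t)) :=
        mul_le_mul_of_nonneg_right hm (Real.exp_pos _).le
    _ ≤ Real.exp (-(t ^ 2 / (2 * C))) := by
        rw [← Real.exp_add, Real.exp_le_exp]
        have h3 : l ^ 2 * ∑ i, c i ^ 2 ≤ l ^ 2 * C := mul_le_mul_of_nonneg_left hcC (sq_nonneg l)
        have h4 : l ^ 2 * C = t ^ 2 / C := by rw [hl]; field_simp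
        have h5 : l * t = t ^ 2 / C := by rw [hl]; field_simp
        have h6 : t ^ 2 / (2 * C) = t ^ 2 / C / 2 := by field_simp
        rw [h6]
        linarith

open Classical in
/-- McDiarmid's inequality, upper tail. -/
theorem mcdiarmid_upper {n : ℕ} {w : Fin n → A → ℝ} (hw : ∀ i a, 0 ≤ w i a)
    (hw1 : ∀ i, ∑ a, w i a = 1) {c : Fin n → ℝ} {f : (Fin n → A) → ℝ}
    (hf : BoundedDifferences c f) {C t : ℝ} (hC : 0 < C) (hcC : ∑ i, c i ^ 2 ≤ C) (ht : 0 ≤ t) :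
    ∑ x, productWeight w x * (if ∑ x, productWeight w x * f x + t ≤ f x then 1 else 0)
      ≤ Real.exp (-(t ^ 2 / (2 * C))) := by
  have hfn : BoundedDifferences c fun x => -f x := by
    intro i x x' h
    rw [← abs_neg]
    convert hf i x x' h using 2
    ring
  refine le_of_eq_of_le (Finset.sum_congr rfl fun x _ => ?_)
    (mcdiarmid_lower hw hw1 hfn hC hcC ht)
  congr 1
  refine if_congr ?_ rfl rfl
  simp only [mul_neg, Finset.sum_neg_distrib]
  constructor <;> intro h <;> linarith

end Concentration

end SparseExtractor
namespace SparseExtractor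

/-! ### Noise stability of Boolean functions. -/

section NoiseStability

/-- The law of a uniform bit together with a copy of it that is flipped with probability `p`. -/
noncomputable def noisePair (p : ℝ) (a : Bool × Bool) : ℝ :=
  (1 / 2) * if a.1 = a.2 then 1 - p else p

theorem noisePair_nonneg {p : ℝ} (h0 : 0 ≤ p) (h1 : p ≤ 1) (a : Bool × Bool) :
    0 ≤ noisePair p a := by
  unfold noisePair
  split_ifs <;> linarith

theorem sum_noisePair (p : ℝ) : ∑ a, noisePair p a = 1 := by
  simp [noisePair, Fintype.sum_prod_type]
  ring

/-- The weight of a uniform string paired with a `p`-noisy copy of it. -/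
noncomputable def noiseWeight {n : ℕ} (p : ℝ) (q : Fin n → Bool × Bool) : ℝ :=
  productWeight (fun _ => noisePair p) q

theorem noiseWeight_nonneg {n : ℕ} {p : ℝ} (h0 : 0 ≤ p) (h1 : p ≤ 1) (q : Fin n → Bool × Bool) :
    0 ≤ noiseWeight p q :=
  productWeight_nonneg (fun _ => noisePair_nonneg h0 h1) q

theorem sum_noiseWeight (n : ℕ) (p : ℝ) : ∑ q : Fin n → Bool × Bool, noiseWeight p q = 1 :=
  sum_productWeight fun _ => sum_noisePair p

/-- The correlation of `F` on a uniform string with `G` on a `p`-noisy copy of it. -/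
noncomputable def noiseCorrelation {n : ℕ} (p : ℝ) (F G : Bits n → ℝ) : ℝ :=
  ∑ q : Fin n → Bool × Bool,
    noiseWeight p q * (F (fun i => (q i).1) * G fun i => (q i).2)

theorem noiseCorrelation_add {n : ℕ} (p : ℝ) (F F' G G' : Bits n → ℝ) :
    noiseCorrelation p (fun x => F x + F' x) (fun x => G x + G' x)
      = noiseCorrelation p F G + noiseCorrelation p F G'
        + noiseCorrelation p F' G + noiseCorrelation p F' G' := by
  simp only [noiseCorrelation, ← Finset.sum_add_distrib]
  exact Finset.sum_congr rfl fun q _ => by ring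

theorem noiseCorrelation_succ {n : ℕ} (p : ℝ) (F G : Bits (n + 1) → ℝ) :
    noiseCorrelation p F G
      = (1 - p) / 2 * (noiseCorrelation p (fun x => F (Fin.cons true x)) (fun x => G (Fin.cons true x))
          + noiseCorrelation p (fun x => F (Fin.cons false x)) (fun x => G (Fin.cons false x)))
        + p / 2 * (noiseCorrelation p (fun x => F (Fin.cons true x)) (fun x => G (Fin.cons false x))
          + noiseCorrelation p (fun x => F (Fin.cons false x))
              (fun x => G (Fin.cons true x))) := by
  have hc : ∀ (a : Bool × Bool) (q : Fin n → Bool × Bool),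
      noiseWeight p (Fin.cons a q : Fin (n + 1) → Bool × Bool)
          * (F (fun i => ((Fin.cons a q : Fin (n + 1) → Bool × Bool) i).1)
            * G fun i => ((Fin.cons a q : Fin (n + 1) → Bool × Bool) i).2)
        = noisePair p a * (noiseWeight p q * (F (Fin.cons a.1 fun i => (q i).1)
            * G (Fin.cons a.2 fun i => (q i).2))) := by
    intro a q
    have h1 : (fun i => ((Fin.cons a q : Fin (n + 1) → Bool × Bool) i).1)
        = (Fin.cons a.1 fun i => (q i).1 : Bits (n + 1)) := by
      funext i
      refine Fin.cases rfl (fun i => rfl) i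
    have h2 : (fun i => ((Fin.cons a q : Fin (n + 1) → Bool × Bool) i).2)
        = (Fin.cons a.2 fun i => (q i).2 : Bits (n + 1)) := by
      funext i
      refine Fin.cases rfl (fun i => rfl) i
    rw [h1, h2, noiseWeight, productWeight_cons, noiseWeight]
    ring
  simp only [noiseCorrelation]
  rw [sum_fin_succ]
  simp only [hc, ← Finset.mul_sum, Fintype.sum_prod_type, Fintype.sum_bool]
  simp only [noisePair, if_true, reduceCtorEq, if_false]
  ring

/-- Polarization absorbs the cross terms into the self-correlation of the sum of the two
restrictions. For `0 ≤ p ≤ 1/2` all coefficients are nonnegative, so lower bounds pass through the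
induction on `n`. -/
theorem noiseCorrelation_succ_self {n : ℕ} (p : ℝ) (F : Bits (n + 1) → ℝ) :
    noiseCorrelation p F F
      = (1 - 2 * p) * ((noiseCorrelation p (fun x => F (Fin.cons true x)) (fun x => F (Fin.cons true x))
          + noiseCorrelation p (fun x => F (Fin.cons false x)) (fun x => F (Fin.cons false x))) / 2)
        + p / 2 * noiseCorrelation p (fun x => F (Fin.cons true x) + F (Fin.cons false x))
            (fun x => F (Fin.cons true x) + F (Fin.cons false x)) := by
  rw [noiseCorrelation_succ, noiseCorrelation_add]
  ring

theorem noiseCorrelation_self_nonneg {n : ℕ} {p : ℝ} (h0 : 0 ≤ p) (h1 : p ≤ 1 / 2)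
    (F : Bits n → ℝ) : 0 ≤ noiseCorrelation p F F := by
  induction n with
  | zero =>
    simp only [noiseCorrelation, noiseWeight, productWeight, Finset.univ_eq_empty,
      Finset.prod_empty, one_mul]
    refine Finset.sum_nonneg fun q _ => ?_
    have : (fun i => (q i).1 : Bits 0) = fun i => (q i).2 := Subsingleton.elim _ _
    rw [this]
    exact mul_self_nonneg _
  | succ n ih =>
    rw [noiseCorrelation_succ_self]
    have h2 := ih fun x => F (Fin.cons true x)
    have h3 := ih fun x => F (Fin.cons false x)
    have h4 := ih fun x => F (Fin.cons true x) + F (Fin.cons false x)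
    have h5 : 0 ≤ 1 - 2 * p := by linarith
    positivity

open Classical in
/-- The noise stability of a `±1`-valued function that depends only on the coordinates in `S`. -/
theorem prod_le_noiseCorrelation_self {n : ℕ} {p : ℝ} (h0 : 0 ≤ p) (h1 : p ≤ 1 / 2)
    (F : Bits n → ℝ) (hF : ∀ x, F x * F x = 1) (S : Fin n → Prop)
    (hS : ∀ i, ¬ S i → ∀ x x' : Bits n, (∀ k, k ≠ i → x k = x' k) → F x = F x') :
    ∏ i, (if S i then 1 - 2 * p else 1) ≤ noiseCorrelation p F F := by
  induction n with
  | zero =>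
    simp only [noiseCorrelation, noiseWeight, productWeight, Finset.univ_eq_empty,
      Finset.prod_empty, one_mul]
    have : ∀ q : Fin 0 → Bool × Bool, F (fun i => (q i).1) * F (fun i => (q i).2) = 1 := by
      intro q
      have : (fun i => (q i).1 : Bits 0) = fun i => (q i).2 := Subsingleton.elim _ _
      rw [this, hF]
    simp [this]
  | succ n ih =>
    have h5 : 0 ≤ 1 - 2 * p := by linarith
    have hrec : ∀ b : Bool, ∏ i : Fin n, (if S i.succ then 1 - 2 * p else 1)
        ≤ noiseCorrelation p (fun x => F (Fin.cons b x)) (fun x => F (Fin.cons b x)) := by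
      intro b
      refine ih (fun x => F (Fin.cons b x)) (fun x => hF _) (fun i => S i.succ) ?_
      intro i hi x x' hx
      refine hS i.succ hi _ _ fun k hk => ?_
      refine Fin.cases (fun _ => rfl) (fun k hk => ?_) k hk
      simpa using hx k fun h => hk (by rw [h])
    rw [Fin.prod_univ_succ]
    -- A relevant coordinate costs a factor `1 - 2p` once the nonnegative sum term is dropped. At an
    -- irrelevant one the two restrictions coincide and nothing is lost.
    by_cases hs : S 0
    · rw [if_pos hs, noiseCorrelation_succ_self]
      have h4 := noiseCorrelation_self_nonneg h0 h1
        fun x : Bits n => F (Fin.cons true x) + F (Fin.cons false x)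
      have h6 := mul_le_mul_of_nonneg_left
        (by linarith [hrec true, hrec false] :
          ∏ i : Fin n, (if S i.succ then 1 - 2 * p else 1)
          ≤ (noiseCorrelation p (fun x => F (Fin.cons true x)) (fun x => F (Fin.cons true x))
          + noiseCorrelation p (fun x => F (Fin.cons false x)) (fun x => F (Fin.cons false x))) / 2) h5
      have h7 := mul_nonneg (by linarith : 0 ≤ p / 2) h4
      linarith
    · rw [if_neg hs, one_mul, noiseCorrelation_succ]
      have heq : (fun x : Bits n => F (Fin.cons false x)) = fun x => F (Fin.cons true x) := by
        funext x
        refine hS 0 hs _ _ fun k hk => ?_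
        obtain ⟨j, rfl⟩ := Fin.exists_succ_eq.2 hk
        rfl
      rw [heq]
      linarith [hrec true]

end NoiseStability

/-! ### Mean agreement of a sparse function on noisy pairs. -/

section Agreement

open Classical in
/-- The number of inputs on which output `j` depends. -/
noncomputable def outDegree {n m : ℕ} (h : Bits n → Bits m) (j : Fin m) : ℕ :=
  (Finset.univ.filter fun i => DependsOn h i j).card

open Classical in
/-- The number of outputs that depend on input `i`. -/
noncomputable def inDegree {n m : ℕ} (h : Bits n → Bits m) (i : Fin n) : ℕ :=
  (Finset.univ.filter fun j => DependsOn h i j).card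

open Classical in
theorem sparsity_eq_card {n m : ℕ} (h : Bits n → Bits m) :
    sparsity h = (Finset.univ.filter fun q : Fin n × Fin m => DependsOn h q.1 q.2).card := by
  rw [sparsity, ← Set.ncard_coe_finset]
  congr 1
  ext q
  simp

theorem sum_inDegree {n m : ℕ} (h : Bits n → Bits m) : ∑ i, inDegree h i = sparsity h := by
  classical
  simp only [sparsity_eq_card, inDegree, Finset.card_filter, Fintype.sum_prod_type]

theorem sum_outDegree {n m : ℕ} (h : Bits n → Bits m) : ∑ j, outDegree h j = sparsity h := by
  classical
  simp only [sparsity_eq_card, outDegree, Finset.card_filter, Fintype.sum_prod_type]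
  exact Finset.sum_comm

/-- The number of coordinates on which two strings agree. -/
noncomputable def agreement {m : ℕ} (a b : Bits m) : ℝ := ∑ j, if a j = b j then 1 else 0

/-- With bits read as signs, the indicator of equality is `(1 + σσ') / 2`. Each output thus
contributes one half plus half its noise stability. -/
theorem half_add_le_mean_agreement {n m : ℕ} {p : ℝ} (h0 : 0 ≤ p) (h1 : p ≤ 1 / 2)
    (g : Bits n → Bits m) :
    (m : ℝ) / 2 + (∑ j, (1 - 2 * p) ^ outDegree g j) / 2
      ≤ ∑ q : Fin n → Bool × Bool,
          noiseWeight p q * agreement (g fun i => (q i).1) (g fun i => (q i).2) := by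
  classical
  let sgn : Bool → ℝ := fun b => if b then 1 else -1
  have hsgn : ∀ a b : Bool, (if a = b then (1 : ℝ) else 0) = (1 + sgn a * sgn b) / 2 := by
    intro a b
    cases a <;> cases b <;> norm_num [sgn]
  have hsq : ∀ a, sgn a * sgn a = 1 := by
    intro a
    cases a <;> norm_num [sgn]
  have hj : ∀ j, (1 - 2 * p) ^ outDegree g j
      ≤ noiseCorrelation p (fun x => sgn (g x j)) (fun x => sgn (g x j)) := by
    intro j
    refine le_trans (le_of_eq ?_) (prod_le_noiseCorrelation_self h0 h1 _ (fun x => hsq _)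
      (fun i => DependsOn g i j) ?_)
    · rw [Finset.prod_ite, Finset.prod_const, Finset.prod_const_one, mul_one, outDegree]
    · intro i hi x x' hx
      have : g x j = g x' j := by
        by_contra hne
        exact hi ⟨x, x', hx, hne⟩
      rw [this]
  have hrw : ∑ q : Fin n → Bool × Bool,
      noiseWeight p q * agreement (g fun i => (q i).1) (g fun i => (q i).2)
      = (m : ℝ) / 2 + (∑ j, noiseCorrelation p (fun x => sgn (g x j)) (fun x => sgn (g x j))) / 2 := by
    simp only [agreement, hsgn, Finset.mul_sum, noiseCorrelation]
    rw [Finset.sum_comm, Finset.sum_div]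
    have hm : (m : ℝ) / 2 = ∑ j : Fin m, (1 : ℝ) / 2 := by simp; ring
    rw [hm, ← Finset.sum_add_distrib]
    refine Finset.sum_congr rfl fun j _ => ?_
    have hW : (1 : ℝ) / 2 = ∑ q : Fin n → Bool × Bool, noiseWeight p q * (1 / 2) := by
      rw [← Finset.sum_mul, sum_noiseWeight, one_mul]
    rw [hW, Finset.sum_div, ← Finset.sum_add_distrib]
    exact Finset.sum_congr rfl fun q _ => by ring
  rw [hrw]
  linarith [Finset.sum_le_sum fun j (_ : j ∈ Finset.univ) => hj j]

/-- The two sides are equal at `p = 0` and `p = 1/4`, and between these points the convex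
exponential lies below its chord. -/
theorem exp_neg_le_one_sub_two_mul {p : ℝ} (h0 : 0 ≤ p) (h1 : p ≤ 1 / 4) :
    Real.exp (-(4 * Real.log 2 * p)) ≤ 1 - 2 * p := by
  have hconv := convexOn_exp.2 (Set.mem_univ (0 : ℝ)) (Set.mem_univ (-Real.log 2))
    (by linarith : 0 ≤ 1 - 4 * p) (by linarith : 0 ≤ 4 * p) (by ring)
  simp only [smul_eq_mul, Real.exp_neg, Real.exp_log (by norm_num : (0 : ℝ) < 2), mul_zero,
    Real.exp_zero, zero_add] at hconv
  have e : -(4 * Real.log 2 * p) = 4 * p * -Real.log 2 := by ring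
  rw [e]
  linarith

/-- Jensen's inequality for the function `d ↦ (1 - 2p)^d`. -/
theorem card_mul_exp_le_sum_pow {m : ℕ} (hm : 0 < m) {p s : ℝ} (h0 : 0 ≤ p) (h1 : p ≤ 1 / 4)
    (d : Fin m → ℕ) (hd : (∑ j, (d j : ℝ)) ≤ s) :
    m * Real.exp (-(4 * Real.log 2 * p * (s / m))) ≤ ∑ j, (1 - 2 * p) ^ d j := by
  set a := 4 * Real.log 2 * p with ha
  have ha0 : 0 ≤ a := by positivity
  have hm' : (0 : ℝ) < m := by exact_mod_cast hm
  -- This is the tangent line of the exponential at `s / m`. Summed over `j`, its linear term is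
  -- nonnegative because the degrees total at most `s`.
  have hpt : ∀ j, Real.exp (-(a * (s / m))) * (1 - a * (d j - s / m)) ≤ (1 - 2 * p) ^ d j := by
    intro j
    have e1 : Real.exp (-(a * d j)) ≤ (1 - 2 * p) ^ d j := by
      have := pow_le_pow_left₀ (Real.exp_pos _).le (exp_neg_le_one_sub_two_mul h0 h1) (d j)
      rw [← Real.exp_nat_mul, ← ha] at this
      rwa [show -(a * d j) = d j * -a by ring]
    refine le_trans ?_ e1
    have e2 : -(a * (d j : ℝ)) = -(a * (s / m)) + -(a * (d j - s / m)) := by ring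
    rw [e2, Real.exp_add]
    refine mul_le_mul_of_nonneg_left ?_ (Real.exp_pos _).le
    linarith [Real.add_one_le_exp (-(a * ((d j : ℝ) - s / m)))]
  refine le_trans ?_ (Finset.sum_le_sum fun j _ => hpt j)
  rw [← Finset.mul_sum, mul_comm]
  refine mul_le_mul_of_nonneg_left ?_ (Real.exp_pos _).le
  rw [Finset.sum_sub_distrib, ← Finset.mul_sum, Finset.sum_sub_distrib]
  simp only [Finset.sum_const, Finset.card_univ, Fintype.card_fin, nsmul_eq_mul, mul_one]
  have : (m : ℝ) * (s / m) = s := by field_simp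
  rw [this]
  nlinarith

end Agreement

end SparseExtractor
namespace SparseExtractor

theorem sum_productWeight_mul_apply {A : Type} [Fintype A] {n : ℕ} {w : Fin n → A → ℝ}
    (hw : ∀ i, ∑ a, w i a = 1) (i : Fin n) (φ : A → ℝ) :
    ∑ x, productWeight w x * φ (x i) = ∑ a, w i a * φ a := by
  classical
  have key := Finset.prod_univ_sum (fun _ : Fin n => (Finset.univ : Finset A))
    (fun k a => w k a * if k = i then φ a else 1)
  rw [Fintype.piFinset_univ] at key
  have h1 : ∀ x : Fin n → A, productWeight w x * φ (x i)
      = ∏ k, (w k (x k) * if k = i then φ (x k) else 1) := by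
    intro x
    rw [Finset.prod_mul_distrib, Finset.prod_ite_eq' Finset.univ i fun k => φ (x k)]
    simp [productWeight]
  rw [Finset.sum_congr rfl fun x _ => h1 x, ← key, Finset.prod_eq_single i]
  · simp
  · intro k _ hk
    simp [hk, hw]
  · simp

/-! ### The tests, and the probability that noisy copies and uniform strings pass them. -/

section Tests

variable {n m : ℕ}

/-- The string that agrees with `z` on `H` and with `y` elsewhere. -/
def override (H : Finset (Fin n)) (z y : Bits n) : Bits n := fun i => if i ∈ H then z i else y i

theorem override_self (H : Finset (Fin n)) (z : Bits n) : override H z z = z := by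
  funext i
  simp [override]

theorem override_congr {H : Finset (Fin n)} {z z' y y' : Bits n} (hz : ∀ i ∈ H, z i = z' i)
    (hy : ∀ i, i ∉ H → y i = y' i) : override H z y = override H z' y' := by
  funext i
  by_cases hi : i ∈ H
  · simp [override, hi, hz i hi]
  · simp [override, hi, hy i hi]

theorem outDegree_override_le (h : Bits n → Bits m) (H : Finset (Fin n)) (z : Bits n)
    (j : Fin m) : outDegree (fun y => h (override H z y)) j ≤ outDegree h j := by
  classical
  refine Finset.card_le_card fun i hi => ?_
  simp only [Finset.mem_filter, Finset.mem_univ, true_and] at hi ⊢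
  obtain ⟨x, x', hx, hne⟩ := hi
  refine ⟨override H z x, override H z x', fun k hk => ?_, hne⟩
  simp only [override, hx k hk]

/-- Only outputs that depend on `i` can react to a change of the pair at `i`, and each shifts the
count by at most one even if both components change. Coordinates in `H` are overwritten by `z` and
have no effect. -/
theorem boundedDifferences_agreement (h : Bits n → Bits m) (H : Finset (Fin n)) (z : Bits n) :
    BoundedDifferences (fun i => if i ∈ H then (0 : ℝ) else inDegree h i)
      fun q : Fin n → Bool × Bool => agreement (h (override H z fun i => (q i).1))
        (h (override H z fun i => (q i).2)) := by
  classical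
  intro i q q' hq
  by_cases hi : i ∈ H
  · have h1 : override H z (fun i => (q i).1) = override H z (fun i => (q' i).1) :=
      override_congr (fun _ _ => rfl) fun k hk => by rw [hq k fun e => hk (e ▸ hi)]
    have h2 : override H z (fun i => (q i).2) = override H z (fun i => (q' i).2) :=
      override_congr (fun _ _ => rfl) fun k hk => by rw [hq k fun e => hk (e ▸ hi)]
    simp [h1, h2, hi]
  · simp only [hi, if_false]
    have hin : (inDegree h i : ℝ) = ∑ j, if DependsOn h i j then 1 else 0 := by
      rw [inDegree, Finset.card_filter]
      push_cast
      rfl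
    rw [agreement, agreement, ← Finset.sum_sub_distrib, hin]
    refine (Finset.abs_sum_le_sum_abs _ _).trans (Finset.sum_le_sum fun j _ => ?_)
    by_cases hd : DependsOn h i j
    · rw [if_pos hd]
      split_ifs <;> norm_num
    · have hdep : ∀ x x' : Bits n, (∀ k, k ≠ i → x k = x' k) → h x j = h x' j := by
        intro x x' hx
        by_contra hne
        exact hd ⟨x, x', hx, hne⟩
      have h1 : h (override H z fun i => (q i).1) j = h (override H z fun i => (q' i).1) j :=
        hdep _ _ fun k hk => by simp only [override, hq k hk]
      have h2 : h (override H z fun i => (q i).2) j = h (override H z fun i => (q' i).2) j :=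
        hdep _ _ fun k hk => by simp only [override, hq k hk]
      simp [h1, h2, hd]

-- The mean is at least `m/2 + 2t` by noise stability, since overriding inputs cannot raise an
-- out-degree. Missing `m/2 + t` is thus a deviation of `t`, and the squared differences sum to at
-- most `D` times the total in-degree.
open Classical in
theorem agreement_tail_of_fixed {p s D t : ℝ} (hp0 : 0 ≤ p) (hp1 : p ≤ 1 / 4) (hm : 0 < m)
    (h : Bits n → Bits m) (hs : (sparsity h : ℝ) ≤ s) (hs0 : 0 < s) (hD : 0 < D)
    (H : Finset (Fin n)) (hH : ∀ i, i ∉ H → (inDegree h i : ℝ) ≤ D) (ht : 0 ≤ t)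
    (ht2 : 2 * t < m * Real.exp (-(4 * Real.log 2 * p * (s / m))) / 2) (z : Bits n) :
    ∑ q : Fin n → Bool × Bool, noiseWeight p q *
        (if agreement (h (override H z fun i => (q i).1)) (h (override H z fun i => (q i).2))
          < m / 2 + t then 1 else 0)
      ≤ Real.exp (-(t ^ 2 / (2 * (D * s)))) := by
  set f : (Fin n → Bool × Bool) → ℝ := fun q =>
    agreement (h (override H z fun i => (q i).1)) (h (override H z fun i => (q i).2)) with hf
  have hc : ∑ i, (if i ∈ H then (0 : ℝ) else inDegree h i) ^ 2 ≤ D * s := by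
    calc ∑ i, (if i ∈ H then (0 : ℝ) else inDegree h i) ^ 2 ≤ ∑ i, D * inDegree h i := by
          refine Finset.sum_le_sum fun i _ => ?_
          split_ifs with hi
          · rw [zero_pow two_ne_zero]
            positivity
          · rw [sq]
            exact mul_le_mul_of_nonneg_right (hH i hi) (Nat.cast_nonneg _)
      _ = D * sparsity h := by rw [← Finset.mul_sum, ← sum_inDegree, Nat.cast_sum]
      _ ≤ D * s := mul_le_mul_of_nonneg_left hs hD.le
  have hmean : m / 2 + 2 * t ≤ ∑ q, noiseWeight p q * f q := by
    have h1 := half_add_le_mean_agreement hp0 (by linarith) fun y => h (override H z y)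
    have h2 : (∑ j, (outDegree (fun y => h (override H z y)) j : ℝ)) ≤ s := by
      refine le_trans ?_ hs
      rw [← sum_outDegree, Nat.cast_sum]
      exact Finset.sum_le_sum fun j _ => by exact_mod_cast outDegree_override_le h H z j
    have h3 := card_mul_exp_le_sum_pow hm hp0 hp1 _ h2
    linarith
  have htail := mcdiarmid_lower (fun _ => noisePair_nonneg hp0 (by linarith))
    (fun _ => sum_noisePair p) (boundedDifferences_agreement h H z) (mul_pos hD hs0) hc ht
  refine le_trans (Finset.sum_le_sum fun q _ => ?_) htail
  refine mul_le_mul_of_nonneg_left ?_ (noiseWeight_nonneg hp0 (by linarith) q)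
  change (if f q < m / 2 + t then (1 : ℝ) else 0)
    ≤ if f q ≤ ∑ q, noiseWeight p q * f q - t then 1 else 0
  split_ifs <;> linarith

theorem add_add_cancel (y x : Bits n) : add y (add y x) = x := by
  funext i
  simp [add]

/-- Addition of a fixed string, as a permutation. -/
def addPerm (y : Bits n) : Equiv.Perm (Bits n) :=
  Function.Involutive.toPerm (add y) (add_add_cancel y)

/-- Simultaneous addition of a fixed string to both components. -/
def addPairPerm (r : Bits n) : Equiv.Perm (Fin n → Bool × Bool) :=
  Function.Involutive.toPerm (fun q i => (xor (r i) (q i).1, xor (r i) (q i).2)) (by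
    intro q
    funext i
    simp)

theorem addPairPerm_apply (r : Bits n) (q : Fin n → Bool × Bool) (i : Fin n) :
    addPairPerm r q i = (xor (r i) (q i).1, xor (r i) (q i).2) := rfl

theorem noiseWeight_addPairPerm (p : ℝ) (r : Bits n) (q : Fin n → Bool × Bool) :
    noiseWeight p (addPairPerm r q) = noiseWeight p q := by
  unfold noiseWeight productWeight
  refine Finset.prod_congr rfl fun i _ => ?_
  simp [noisePair, addPairPerm_apply]

/-- If the value of `B z q` depends on `z` only through its restriction to `H` and on `q` only
through its restriction to the complement of `H`, the second component of `q` may be substituted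
for `z` in a bound that is uniform in `z`. -/
theorem sum_noiseWeight_diagonal_le {p δ : ℝ} (H : Finset (Fin n))
    (B : Bits n → (Fin n → Bool × Bool) → ℝ)
    (hB : ∀ z z' q q', (∀ i ∈ H, z i = z' i) → (∀ i, i ∉ H → q i = q' i) → B z q = B z' q')
    (hδ : ∀ z, ∑ q, noiseWeight p q * B z q ≤ δ) :
    ∑ q, noiseWeight p q * B (fun i => (q i).2) q ≤ δ := by
  classical
  -- Adding `r`, cut down to `H`, to both components preserves the noise weight and is invisible to
  -- the second argument of `B`. Averaging over `r` turns the first argument into a uniform string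
  -- independent of `q`.
  have hr : ∀ r : Bits n, ∑ q, noiseWeight p q * B (fun i => (q i).2) q
      = ∑ q, noiseWeight p q * B (add (fun i => (q i).2) r) q := by
    intro r
    let r' : Bits n := fun i => if i ∈ H then r i else false
    rw [← Equiv.sum_comp (addPairPerm r')]
    refine Finset.sum_congr rfl fun q _ => ?_
    rw [noiseWeight_addPairPerm]
    congr 1
    refine hB _ _ _ _ (fun i hi => ?_) fun i hi => ?_
    · simp [addPairPerm, r', hi, add, Bool.xor_comm]
    · simp [addPairPerm, r', hi]
  have hsum : (Fintype.card (Bits n) : ℝ) * ∑ q, noiseWeight p q * B (fun i => (q i).2) q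
      = ∑ z, ∑ q, noiseWeight p q * B z q := by
    calc (Fintype.card (Bits n) : ℝ) * ∑ q, noiseWeight p q * B (fun i => (q i).2) q
        = ∑ r : Bits n, ∑ q, noiseWeight p q * B (add (fun i => (q i).2) r) q := by
          rw [← Finset.sum_congr rfl fun r _ => hr r]
          simp
      _ = ∑ q, ∑ r : Bits n, noiseWeight p q * B (add (fun i => (q i).2) r) q :=
          Finset.sum_comm
      _ = ∑ q, ∑ z : Bits n, noiseWeight p q * B z q :=
          Finset.sum_congr rfl fun q _ =>
            Equiv.sum_comp (addPerm fun i => (q i).2) fun z => noiseWeight p q * B z q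
      _ = _ := Finset.sum_comm
  have hcard : (0 : ℝ) < Fintype.card (Bits n) := by exact_mod_cast Fintype.card_pos
  refine le_of_mul_le_mul_left ?_ hcard
  rw [hsum]
  refine (Finset.sum_le_sum fun z _ => hδ z).trans (le_of_eq ?_)
  simp

/-- The strings that agree in at least `θ` places with a value of `h` on some modification of `y`
on `H`. -/
def testSet (h : Bits n → Bits m) (H : Finset (Fin n)) (θ : ℝ) (y : Bits n) : Set (Bits m) :=
  {u | ∃ z, θ ≤ agreement (h (override H z y)) u}

-- The witness for membership is `z = v`, the noisy string itself, for which `override H v v = v`.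
-- Although `z` then depends on the noise, `sum_noiseWeight_diagonal_le` carries over the bound for
-- fixed `z`.
open Classical in
theorem noise_notMem_testSet_le {p s D t : ℝ} (hp0 : 0 ≤ p) (hp1 : p ≤ 1 / 4) (hm : 0 < m)
    (h : Bits n → Bits m) (hs : (sparsity h : ℝ) ≤ s) (hs0 : 0 < s) (hD : 0 < D)
    (H : Finset (Fin n)) (hH : ∀ i, i ∉ H → (inDegree h i : ℝ) ≤ D) (ht : 0 ≤ t)
    (ht2 : 2 * t < m * Real.exp (-(4 * Real.log 2 * p * (s / m))) / 2) :
    ∑ q : Fin n → Bool × Bool, noiseWeight p q *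
        (if h (fun i => (q i).2) ∈ testSet h H (m / 2 + t) (fun i => (q i).1) then 0 else 1)
      ≤ Real.exp (-(t ^ 2 / (2 * (D * s)))) := by
  refine le_trans (Finset.sum_le_sum fun q _ => ?_) (sum_noiseWeight_diagonal_le H
    (fun z q => if agreement (h (override H z fun i => (q i).1))
      (h (override H z fun i => (q i).2)) < m / 2 + t then 1 else 0) ?_
    (agreement_tail_of_fixed hp0 hp1 hm h hs hs0 hD H hH ht ht2))
  · refine mul_le_mul_of_nonneg_left ?_ (noiseWeight_nonneg hp0 (by linarith) q)
    rw [override_self]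
    by_cases hmem : h (fun i => (q i).2) ∈ testSet h H (m / 2 + t) (fun i => (q i).1)
    · rw [if_pos hmem]
      split_ifs <;> norm_num
    · rw [if_neg hmem, if_pos]
      by_contra hle
      exact hmem ⟨_, not_lt.1 hle⟩
  · intro z z' q q' hz hq
    rw [override_congr hz fun i hi => by rw [hq i hi],
      override_congr (y := fun i => (q i).2) hz fun i hi => by rw [hq i hi]]

open Classical in
theorem uniform_agreement_tail (hm : 0 < m) (a : Bits m) {t : ℝ} (ht : 0 ≤ t) :
    ∑ u : Bits m, (1 / 2 : ℝ) ^ m * (if (m : ℝ) / 2 + t ≤ agreement a u then 1 else 0)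
      ≤ Real.exp (-(t ^ 2 / (2 * m))) := by
  have hw1 : ∀ _ : Fin m, ∑ _ : Bool, (1 / 2 : ℝ) = 1 := by
    intro _
    simp
  have hpw : ∀ u : Bits m, productWeight (fun _ _ => (1 / 2 : ℝ)) u = (1 / 2 : ℝ) ^ m := by
    intro u
    simp [productWeight]
  have hmean : ∑ u : Bits m, productWeight (fun _ _ => (1 / 2 : ℝ)) u * agreement a u
      = (m : ℝ) / 2 := by
    simp only [agreement, Finset.mul_sum]
    rw [Finset.sum_comm]
    have hj : ∀ j : Fin m, ∑ u : Bits m, productWeight (fun _ _ => (1 / 2 : ℝ)) u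
        * (if a j = u j then 1 else 0) = 1 / 2 := by
      intro j
      rw [sum_productWeight_mul_apply hw1 j fun b => if a j = b then (1 : ℝ) else 0]
      cases a j <;> simp
    rw [Finset.sum_congr rfl fun j _ => hj j]
    simp
    ring
  have hb : BoundedDifferences (fun _ => (1 : ℝ)) fun u : Bits m => agreement a u := by
    intro i u u' hu
    simp only [agreement]
    rw [← Finset.sum_sub_distrib, Finset.sum_eq_single i]
    · split_ifs <;> norm_num
    · intro k _ hk
      rw [hu k hk, sub_self]
    · simp
  have := mcdiarmid_upper (fun _ _ => by norm_num) hw1 hb (C := m) (by exact_mod_cast hm)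
    (by simp) ht
  rw [hmean] at this
  simpa only [hpw] using this

open Classical in
theorem uniform_testSet_le (hm : 0 < m) (h : Bits n → Bits m) (H : Finset (Fin n)) {t : ℝ}
    (ht : 0 ≤ t) (y : Bits n) :
    ∑ u : Bits m, (1 / 2 : ℝ) ^ m * (if u ∈ testSet h H (m / 2 + t) y then 1 else 0)
      ≤ 2 ^ H.card * Real.exp (-(t ^ 2 / (2 * m))) := by
  -- Only the restriction of `z` to `H` matters, so the union bound runs over representatives that
  -- are `false` off `H`.
  let Z : Finset (Bits n) := Fintype.piFinset fun i => if i ∈ H then Finset.univ else {false}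
  have hZ : Z.card = 2 ^ H.card := by
    rw [Fintype.card_piFinset]
    have : ∀ i, (if i ∈ H then (Finset.univ : Finset Bool) else {false}).card
        = if i ∈ H then 2 else 1 := by
      intro i
      split_ifs <;> simp
    rw [Finset.prod_congr rfl fun i _ => this i, Finset.prod_ite_mem]
    simp
  calc ∑ u : Bits m, (1 / 2 : ℝ) ^ m * (if u ∈ testSet h H (m / 2 + t) y then 1 else 0)
      ≤ ∑ u : Bits m, ∑ z ∈ Z, (1 / 2 : ℝ) ^ m *
          (if (m : ℝ) / 2 + t ≤ agreement (h (override H z y)) u then 1 else 0) := by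
        refine Finset.sum_le_sum fun u _ => ?_
        rw [← Finset.mul_sum]
        refine mul_le_mul_of_nonneg_left ?_ (by positivity)
        split_ifs with hu
        · obtain ⟨z, hz⟩ := hu
          have hov : override H (fun i => if i ∈ H then z i else false) y = override H z y :=
            override_congr (fun i hi => by simp [hi]) fun _ _ => rfl
          rw [← hov] at hz
          refine le_trans (by rw [if_pos hz]) (Finset.single_le_sum (f := fun z =>
            if (m : ℝ) / 2 + t ≤ agreement (h (override H z y)) u then (1 : ℝ) else 0)
            (fun z _ => by split_ifs <;> norm_num)
            (a := fun i => if i ∈ H then z i else false) ?_)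
          rw [Fintype.mem_piFinset]
          intro i
          split_ifs <;> simp
        · exact Finset.sum_nonneg fun z _ => by split_ifs <;> norm_num
    _ = ∑ z ∈ Z, ∑ u : Bits m, (1 / 2 : ℝ) ^ m *
          (if (m : ℝ) / 2 + t ≤ agreement (h (override H z y)) u then 1 else 0) :=
        Finset.sum_comm
    _ ≤ ∑ z ∈ Z, Real.exp (-(t ^ 2 / (2 * m))) :=
        Finset.sum_le_sum fun z _ => uniform_agreement_tail hm _ ht
    _ = _ := by
        rw [Finset.sum_const, hZ, nsmul_eq_mul]
        push_cast
        rfl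

theorem card_highDegree_mul_le (h : Bits n → Bits m) {s D : ℝ} (hs : (sparsity h : ℝ) ≤ s) :
    ((Finset.univ.filter fun i => D < inDegree h i).card : ℝ) * D ≤ s := by
  refine le_trans ?_ hs
  rw [← sum_inDegree, Nat.cast_sum, ← nsmul_eq_mul, ← Finset.sum_const]
  refine (Finset.sum_le_sum fun i hi => (Finset.mem_filter.1 hi).2.le).trans ?_
  exact Finset.sum_le_sum_of_subset_of_nonneg (Finset.filter_subset _ _)
    fun i _ _ => Nat.cast_nonneg _

/-- The weight of a point under the `p`-biased distribution. -/
noncomputable def biasedWeight (p : ℝ) (x : Bits n) : ℝ :=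
  productWeight (fun _ b => if b = true then p else 1 - p) x

theorem biasedWeight_nonneg {p : ℝ} (h0 : 0 ≤ p) (h1 : p ≤ 1) (x : Bits n) :
    0 ≤ biasedWeight p x :=
  productWeight_nonneg (fun _ b => by split_ifs <;> linarith) x

theorem sum_biasedWeight (n : ℕ) (p : ℝ) : ∑ x : Bits n, biasedWeight p x = 1 :=
  sum_productWeight fun _ => by simp

-- The lower tail is taken at deviation `0.1pn` with unit differences: `(0.1pn)^2 / (2n) = p^2 n /
-- 200`.
open Classical in
theorem biased_low_weight_le (hn : 0 < n) {p : ℝ} (h0 : 0 ≤ p) (h1 : p ≤ 1) :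
    ∑ x : Bits n, biasedWeight p x * (if 0.9 * p * n ≤ weight x then 0 else 1)
      ≤ Real.exp (-(p ^ 2 * n / 200)) := by
  have hw : ∀ (_ : Fin n) (b : Bool), 0 ≤ if b = true then p else 1 - p := by
    intro _ b
    split_ifs <;> linarith
  have hw1 : ∀ _ : Fin n, ∑ b : Bool, (if b = true then p else 1 - p) = 1 := by simp
  have hwt : ∀ x : Bits n, (weight x : ℝ) = ∑ i, if x i = true then (1 : ℝ) else 0 := by
    intro x
    rw [weight, Finset.card_filter]
    push_cast
    rfl
  have hmean : ∑ x : Bits n, productWeight (fun _ b => if b = true then p else 1 - p) x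
      * (weight x : ℝ) = p * n := by
    simp only [hwt, Finset.mul_sum]
    rw [Finset.sum_comm]
    rw [Finset.sum_congr rfl fun j _ => sum_productWeight_mul_apply hw1 j
      fun b => if b = true then (1 : ℝ) else 0]
    simp
    ring
  have hb : BoundedDifferences (fun _ => (1 : ℝ)) fun x : Bits n => (weight x : ℝ) := by
    intro i u u' hu
    simp only [hwt]
    rw [← Finset.sum_sub_distrib, Finset.sum_eq_single i]
    · split_ifs <;> norm_num
    · intro k _ hk
      rw [hu k hk, sub_self]
    · simp
  have hn' : (0 : ℝ) < n := by exact_mod_cast hn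
  have := mcdiarmid_lower hw hw1 hb (C := n) (t := 0.1 * p * n) hn' (by simp) (by positivity)
  rw [hmean] at this
  refine le_trans (Finset.sum_le_sum fun x _ => ?_) (this.trans (le_of_eq ?_))
  · refine mul_le_mul_of_nonneg_left ?_ (biasedWeight_nonneg h0 h1 x)
    split_ifs <;> linarith
  · congr 2
    field_simp
    ring

end Tests

end SparseExtractor
namespace SparseExtractor

/-! ### Expectations, statistical distance and the averaged distinguishing bound. -/

section Distributions

theorem expectation_eq_sum {α : Type} [Fintype α] (P : PMF α) (f : α → ℝ) :
    expectation P f = ∑ x, (P x).toReal * f x :=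
  tsum_fintype _

theorem sum_toReal {α : Type} [Fintype α] (P : PMF α) : ∑ x, (P x).toReal = 1 := by
  rw [← ENNReal.toReal_sum fun x _ => P.apply_ne_top x, ← tsum_fintype (L := .unconditional _),
    P.tsum_coe, ENNReal.toReal_one]

/-- The target `β` need not be finite: it is also applied with `β` the type of distributions on bit
strings. -/
theorem expectation_map {α β : Type} [Fintype α] (P : PMF α) (g : α → β) (f : β → ℝ) :
    expectation (P.map g) f = ∑ x, (P x).toReal * f (g x) := by
  classical
  have h1 : ∀ b, ((P.map g) b).toReal * f b
      = ∑ a, if b = g a then (P a).toReal * f (g a) else 0 := by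
    intro b
    rw [PMF.map_apply, tsum_fintype, ENNReal.toReal_sum, Finset.sum_mul]
    · refine Finset.sum_congr rfl fun a _ => ?_
      split_ifs with hb
      · rw [hb]
      · simp
    · intro a _
      split_ifs
      · exact P.apply_ne_top a
      · simp
  rw [expectation, tsum_congr h1, Summable.tsum_finsetSum]
  · refine Finset.sum_congr rfl fun a _ => ?_
    rw [tsum_ite_eq]
  · intro a _
    exact (hasSum_ite_eq (g a) _).summable

theorem expectation_bind {α β : Type} [Fintype α] [Fintype β] (P : PMF α) (g : α → PMF β)
    (f : β → ℝ) : expectation (P.bind g) f = ∑ a, (P a).toReal * expectation (g a) f := by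
  have h1 : ∀ b, ((P.bind g) b).toReal = ∑ a, (P a).toReal * (g a b).toReal := by
    intro b
    rw [PMF.bind_apply, tsum_fintype, ENNReal.toReal_sum]
    · simp only [ENNReal.toReal_mul]
    · intro a _
      exact ENNReal.mul_ne_top (P.apply_ne_top a) ((g a).apply_ne_top b)
  simp only [expectation_eq_sum, h1, Finset.sum_mul, Finset.mul_sum]
  rw [Finset.sum_comm]
  exact Finset.sum_congr rfl fun a _ => Finset.sum_congr rfl fun b _ => by ring

theorem uniform_toReal (n : ℕ) (x : Bits n) : (uniform n x).toReal = (1 / 2 : ℝ) ^ n := by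
  simp [uniform, PMF.uniformOfFintype_apply]

theorem toReal_eq_expectation {α : Type} [Fintype α] [DecidableEq α] (P : PMF α) (x : α) :
    (P x).toReal = expectation P fun a => if a = x then 1 else 0 := by
  simp [expectation_eq_sum]

-- As `P - Q` has total mass zero, the indicator of `T` may be replaced by half the sign that is `1`
-- on `T` and `-1` off it.
open Classical in
theorem expectation_indicator_sub_le_statDist {α : Type} [Fintype α] (P Q : PMF α) (T : Set α) :
    (expectation P fun x => if x ∈ T then 1 else 0) - (expectation Q fun x => if x ∈ T then 1 else 0)
      ≤ statDist P Q := by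
  have h1 : (expectation P fun x => if x ∈ T then 1 else 0)
      - (expectation Q fun x => if x ∈ T then 1 else 0)
      = (1 / 2) * ∑ x, ((P x).toReal - (Q x).toReal) * (if x ∈ T then 1 else -1) := by
    have h2 : ∑ x, ((P x).toReal - (Q x).toReal) = 0 := by
      rw [Finset.sum_sub_distrib, sum_toReal, sum_toReal, sub_self]
    rw [expectation_eq_sum, expectation_eq_sum, ← Finset.sum_sub_distrib, Finset.mul_sum]
    have h3 : ∀ x, (P x).toReal * (if x ∈ T then 1 else 0) - (Q x).toReal * (if x ∈ T then 1 else 0)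
        = 1 / 2 * (((P x).toReal - (Q x).toReal) * (if x ∈ T then 1 else -1))
          + 1 / 2 * ((P x).toReal - (Q x).toReal) := by
      intro x
      split_ifs <;> ring
    rw [Finset.sum_congr rfl fun x _ => h3 x, Finset.sum_add_distrib,
      ← Finset.mul_sum Finset.univ fun x => (P x).toReal - (Q x).toReal, h2, mul_zero, add_zero]
  rw [h1, statDist]
  refine mul_le_mul_of_nonneg_left (Finset.sum_le_sum fun x _ => ?_) (by norm_num)
  split_ifs
  · rw [mul_one]
    exact le_abs_self _
  · rw [mul_neg_one]
    exact neg_le_abs _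

theorem le_minEntropy {α : Type} [Fintype α] (P : PMF α) {k : ℝ}
    (h : ∀ x, (P x).toReal ≤ (2 : ℝ) ^ (-k)) : k ≤ minEntropy P := by
  obtain ⟨x, hx⟩ := P.support_nonempty
  have : Nonempty α := ⟨x⟩
  have hpos : 0 < (P x).toReal := ENNReal.toReal_pos hx (P.apply_ne_top x)
  have hle : (P x).toReal ≤ ⨆ x, (P x).toReal :=
    le_ciSup (Set.finite_range fun x => (P x).toReal).bddAbove x
  have := Real.logb_le_logb_of_le (by norm_num : (1 : ℝ) < 2) (hpos.trans_le hle) (ciSup_le h)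
  rw [Real.logb_rpow (by norm_num) (by norm_num)] at this
  rw [minEntropy]
  linarith

variable {n : ℕ}

theorem biased_toReal (p : unitInterval) (x : Bits n) :
    (biased n p x).toReal = biasedWeight (p : ℝ) x := by
  rw [biased, PMF.ofFintype_apply, ENNReal.toReal_ofReal]
  · rfl
  · exact biasedWeight_nonneg p.2.1 p.2.2 x

theorem expectation_truncatedBiased (p : unitInterval) (f : Bits n → ℝ) :
    expectation (truncatedBiased n p) f = ∑ x, biasedWeight (p : ℝ) x *
      (if 0.9 * (p : ℝ) * n ≤ weight x then f x else expectation (uniform n) f) := by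
  rw [truncatedBiased, expectation_bind]
  refine Finset.sum_congr rfl fun x _ => ?_
  rw [biased_toReal]
  split_ifs
  · congr 1
    classical
    rw [expectation_eq_sum, Finset.sum_eq_single x]
    · simp
    · intro b _ hb
      simp [PMF.pure_apply, hb]
    · simp
  · rfl

theorem expectation_shift (y : Bits n) (P : PMF (Bits n)) (f : Bits n → ℝ) :
    expectation (shift y P) f = expectation P fun x => f (add y x) := by
  rw [shift, expectation_map, expectation_eq_sum]

/-- Substituting `x ↦ y + x` shows that a uniform `y` and its biased shift form a noisy pair,
coordinate by coordinate. -/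
theorem sum_uniform_mul_biasedWeight (p : ℝ) (φ : Bits n → Bits n → ℝ) :
    ∑ y : Bits n, (1 / 2 : ℝ) ^ n * ∑ x, biasedWeight p x * φ y (add y x)
      = ∑ q : Fin n → Bool × Bool, noiseWeight p q * φ (fun i => (q i).1) fun i => (q i).2 := by
  rw [← Equiv.sum_comp (Equiv.arrowProdEquivProdArrow (Fin n) (fun _ => Bool) fun _ => Bool).symm,
    Fintype.sum_prod_type]
  refine Finset.sum_congr rfl fun y _ => ?_
  rw [Finset.mul_sum, ← Equiv.sum_comp (addPerm y)]
  refine Finset.sum_congr rfl fun x _ => ?_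
  rw [← mul_assoc]
  have hx : addPerm y x = add y x := rfl
  rw [hx, add_add_cancel]
  change _ = noiseWeight p (fun i => (y i, x i)) * φ y x
  congr 1
  have hc : (1 / 2 : ℝ) ^ n = ∏ _i : Fin n, (1 / 2 : ℝ) := by simp
  rw [biasedWeight, noiseWeight, productWeight, productWeight, hc, ← Finset.prod_mul_distrib]
  refine Finset.prod_congr rfl fun i _ => ?_
  simp only [add, noisePair]
  rcases Bool.eq_false_or_eq_true (y i) with hy | hy <;>
    rcases Bool.eq_false_or_eq_true (x i) with hx | hx <;> simp [hy, hx]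

theorem expectation_shiftedTruncatedBiased (p : unitInterval) (f : PMF (Bits n) → ℝ) :
    expectation (shiftedTruncatedBiased n p) f
      = ∑ y : Bits n, (1 / 2 : ℝ) ^ n * f (shift y (truncatedBiased n p)) := by
  rw [shiftedTruncatedBiased, expectation_map]
  simp only [uniform_toReal]

/-- The mean distance from uniform of the images of the shifted truncated biased distributions. -/
theorem one_sub_le_expectation_statDist {m : ℕ} {p : unitInterval} {s D t : ℝ}
    (hn : 0 < n) (hp1 : (p : ℝ) ≤ 1 / 4) (hm : 0 < m)
    (h : Bits n → Bits m) (hs : (sparsity h : ℝ) ≤ s) (hs0 : 0 < s) (hD : 0 < D) (ht : 0 ≤ t)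
    (ht2 : 2 * t < m * Real.exp (-(4 * Real.log 2 * p * (s / m))) / 2) :
    1 - (Real.exp (-(t ^ 2 / (2 * (D * s)))) + Real.exp (-((p : ℝ) ^ 2 * n / 200))
        + (2 : ℝ) ^ (s / D) * Real.exp (-(t ^ 2 / (2 * m))))
      ≤ expectation (shiftedTruncatedBiased n p) fun X => statDist (X.map h) (uniform m) := by
  classical
  set H : Finset (Fin n) := Finset.univ.filter fun i => D < inDegree h i with hHdef
  have hH : ∀ i, i ∉ H → (inDegree h i : ℝ) ≤ D := by
    intro i hi
    simpa [hHdef] using hi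
  have hcard : (2 : ℝ) ^ H.card ≤ (2 : ℝ) ^ (s / D) := by
    rw [← Real.rpow_natCast]
    refine Real.rpow_le_rpow_of_exponent_le (by norm_num) ?_
    rw [le_div_iff₀ hD]
    exact card_highDegree_mul_le h hs
  have hp0 : (0 : ℝ) ≤ p := p.2.1
  set T := testSet h H (m / 2 + t) with hT
  let φ : Bits n → Bits n → ℝ := fun y v => if h v ∈ T y then 0 else 1
  let low : Bits n → ℝ := fun x => if 0.9 * (p : ℝ) * n ≤ weight x then 0 else 1
  have hpt : ∀ y : Bits n, 1 - ((∑ x, biasedWeight (p : ℝ) x * φ y (add y x))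
        + Real.exp (-((p : ℝ) ^ 2 * n / 200))
        + (2 : ℝ) ^ (s / D) * Real.exp (-(t ^ 2 / (2 * m))))
      ≤ statDist ((shift y (truncatedBiased n p)).map h) (uniform m) := by
    intro y
    refine le_trans ?_ (expectation_indicator_sub_le_statDist _ _ (T y))
    have hU : (expectation (uniform m) fun u => if u ∈ T y then 1 else 0)
        ≤ (2 : ℝ) ^ (s / D) * Real.exp (-(t ^ 2 / (2 * m))) := by
      rw [expectation_eq_sum]
      simp only [uniform_toReal]
      exact (uniform_testSet_le hm h H ht y).trans
        (mul_le_mul_of_nonneg_right hcard (Real.exp_pos _).le)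
    have hX : 1 - ((∑ x, biasedWeight (p : ℝ) x * φ y (add y x))
          + Real.exp (-((p : ℝ) ^ 2 * n / 200)))
        ≤ expectation ((shift y (truncatedBiased n p)).map h) fun u => if u ∈ T y then 1 else 0 := by
      rw [expectation_map, ← expectation_eq_sum (shift y _) fun x => if h x ∈ T y then (1 : ℝ) else 0,
        expectation_shift, expectation_truncatedBiased]
      have h1 : ∑ x, biasedWeight (p : ℝ) x * low x ≤ Real.exp (-((p : ℝ) ^ 2 * n / 200)) := by
        convert biased_low_weight_le hn hp0 p.2.2
      -- On low weight the fresh uniform string is credited with nothing, so truncation costs at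
      -- most the probability of that event.
      have h2 : ∑ x, biasedWeight (p : ℝ) x * (1 - φ y (add y x) - low x)
          ≤ ∑ x, biasedWeight (p : ℝ) x * (if 0.9 * (p : ℝ) * n ≤ weight x then
            (if h (add y x) ∈ T y then (1 : ℝ) else 0)
            else expectation (uniform n) fun x => if h (add y x) ∈ T y then 1 else 0) := by
        refine Finset.sum_le_sum fun x _ =>
          mul_le_mul_of_nonneg_left ?_ (biasedWeight_nonneg hp0 p.2.2 x)
        have hE : 0 ≤ expectation (uniform n) fun x => if h (add y x) ∈ T y then 1 else 0 := by
          rw [expectation_eq_sum]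
          exact Finset.sum_nonneg fun x _ => by split_ifs <;> simp
        simp only [φ, low]
        split_ifs <;> linarith
      refine le_trans ?_ h2
      simp only [mul_sub, mul_one, Finset.sum_sub_distrib, sum_biasedWeight]
      linarith
    linarith
  rw [expectation_shiftedTruncatedBiased]
  have hunif : ∑ _y : Bits n, (1 / 2 : ℝ) ^ n = 1 := by
    simpa only [uniform_toReal] using sum_toReal (uniform n)
  refine le_trans ?_ (Finset.sum_le_sum fun y _ =>
    mul_le_mul_of_nonneg_left (hpt y) (by positivity))
  simp only [mul_sub, mul_add, mul_one, Finset.sum_sub_distrib, Finset.sum_add_distrib,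
    ← Finset.sum_mul, hunif, one_mul, sum_uniform_mul_biasedWeight]
  have := noise_notMem_testSet_le hp0 hp1 hm h hs hs0 hD H hH ht ht2
  linarith

/-- The error of a strong extractor family is the mean error of its members. -/
theorem statDist_pair_eq {m : ℕ} (F : PMF (Bits n → Bits m)) (X : PMF (Bits n)) :
    statDist (F.bind fun h => X.map fun x => (h, h x))
        (F.bind fun h => (uniform m).map fun u => (h, u))
      = ∑ h, (F h).toReal * statDist (X.map h) (uniform m) := by
  classical
  have h1 : ∀ (h : Bits n → Bits m) (u : Bits m),
      ((F.bind fun h => X.map fun x => (h, h x)) (h, u)).toReal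
        = (F h).toReal * ((X.map h) u).toReal := by
    intro h u
    rw [toReal_eq_expectation (F.bind _), expectation_bind, Finset.sum_eq_single h]
    · rw [expectation_map, toReal_eq_expectation (X.map h), expectation_map]
      simp
    · intro h' _ hne
      rw [expectation_map]
      simp [hne]
    · simp
  have h2 : ∀ (h : Bits n → Bits m) (u : Bits m),
      ((F.bind fun h => (uniform m).map fun u => (h, u)) (h, u)).toReal
        = (F h).toReal * (uniform m u).toReal := by
    intro h u
    rw [toReal_eq_expectation (F.bind _), expectation_bind, Finset.sum_eq_single h]
    · rw [expectation_map]
      simp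
    · intro h' _ hne
      rw [expectation_map]
      simp [hne]
    · simp
  rw [statDist, Fintype.sum_prod_type, Finset.mul_sum]
  refine Finset.sum_congr rfl fun h _ => ?_
  rw [statDist, mul_left_comm]
  congr 1
  rw [Finset.mul_sum]
  refine Finset.sum_congr rfl fun u _ => ?_
  rw [h1, h2, ← mul_sub, abs_mul, abs_of_nonneg ENNReal.toReal_nonneg]

theorem statDist_nonneg {α : Type} [Fintype α] (P Q : PMF α) : 0 ≤ statDist P Q :=
  mul_nonneg (by norm_num) (Finset.sum_nonneg fun _ _ => abs_nonneg _)

/-- For each shift the extractor error is an `F`-average of distances. After averaging over `y` and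
exchanging sums, members of `S` contribute at least `δ` each and the others at least `0`. -/
theorem IsStrongExtractorFamily.prob_mul_le {m : ℕ} {k ε δ : ℝ} {F : PMF (Bits n → Bits m)}
    (hF : IsStrongExtractorFamily k ε F) (S : Set (Bits n → Bits m)) (D : PMF (Bits n))
    (hk : ∀ y, k ≤ minEntropy (shift y D))
    (hS : ∀ h ∈ S, δ ≤ ∑ y : Bits n, (1 / 2 : ℝ) ^ n
      * statDist ((shift y D).map h) (uniform m)) :
    (F.toOuterMeasure S).toReal * δ ≤ ε := by
  classical
  have hunif : ∑ _y : Bits n, (1 / 2 : ℝ) ^ n = 1 := by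
    simpa only [uniform_toReal] using sum_toReal (uniform n)
  have hprob : (F.toOuterMeasure S).toReal = ∑ h, if h ∈ S then (F h).toReal else 0 := by
    rw [PMF.toOuterMeasure_apply_fintype, ENNReal.toReal_sum]
    · refine Finset.sum_congr rfl fun h _ => ?_
      by_cases hh : h ∈ S <;> simp [hh]
    · intro h _
      by_cases hh : h ∈ S <;> simp [hh, F.apply_ne_top]
  calc (F.toOuterMeasure S).toReal * δ
      ≤ ∑ h, (F h).toReal * ∑ y : Bits n, (1 / 2 : ℝ) ^ n
          * statDist ((shift y D).map h) (uniform m) := by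
        rw [hprob, Finset.sum_mul]
        refine Finset.sum_le_sum fun h _ => ?_
        split_ifs with hh
        · exact mul_le_mul_of_nonneg_left (hS h hh) ENNReal.toReal_nonneg
        · rw [zero_mul]
          exact mul_nonneg ENNReal.toReal_nonneg (Finset.sum_nonneg fun y _ =>
            mul_nonneg (by positivity) (statDist_nonneg _ _))
    _ = ∑ y : Bits n, (1 / 2 : ℝ) ^ n * ∑ h, (F h).toReal
          * statDist ((shift y D).map h) (uniform m) := by
        simp only [Finset.mul_sum]
        rw [Finset.sum_comm]
        exact Finset.sum_congr rfl fun y _ => Finset.sum_congr rfl fun h _ => by ring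
    _ ≤ ∑ y : Bits n, (1 / 2 : ℝ) ^ n * ε := by
        refine Finset.sum_le_sum fun y _ => mul_le_mul_of_nonneg_left ?_ (by positivity)
        rw [← statDist_pair_eq]
        exact hF.2 _ (hk y)
    _ = ε := by rw [← Finset.sum_mul, hunif, one_mul]

/-! ### Min-entropy of the shifted truncated sources. -/

theorem biasedWeight_eq (p : ℝ) (x : Bits n) :
    biasedWeight p x = p ^ weight x * (1 - p) ^ (n - weight x) := by
  classical
  rw [biasedWeight, productWeight, Finset.prod_ite, Finset.prod_const, Finset.prod_const, weight]
  congr 2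
  have := Finset.card_filter_add_card_filter_not (s := (Finset.univ : Finset (Fin n)))
    fun i => x i = true
  rw [Finset.card_univ, Fintype.card_fin] at this
  omega

theorem weight_le (x : Bits n) : weight x ≤ n := by
  simpa [weight] using Finset.card_filter_le (Finset.univ : Finset (Fin n)) fun i => x i = true

/-- For `p ≤ 1/2` the probability decreases with the weight, so the worst case is weight `0.9pn`.
There the number of zeros, `n - 0.9pn`, is still at least `0.9 n (1-p)`. -/
theorem biasedWeight_le_of_weight {p : ℝ} (h0 : 0 < p) (h1 : p ≤ 1 / 2) (x : Bits n)
    (hx : 0.9 * p * n ≤ weight x) :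
    biasedWeight p x ≤ Real.exp (-(0.9 * n * Real.binEntropy p)) := by
  have hq : 0 < 1 - p := by linarith
  have hl1 : Real.log p ≤ Real.log (1 - p) := Real.log_le_log h0 (by linarith)
  have hl2 : Real.log (1 - p) ≤ 0 := Real.log_nonpos hq.le (by linarith)
  have e1 : biasedWeight p x
      = Real.exp (weight x * Real.log p + (n - weight x) * Real.log (1 - p)) := by
    rw [biasedWeight_eq, Real.exp_add, ← Nat.cast_sub (weight_le x), Real.exp_nat_mul,
      Real.exp_nat_mul, Real.exp_log h0, Real.exp_log hq]
  rw [e1, Real.exp_le_exp, Real.binEntropy, Real.log_inv, Real.log_inv]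
  have h3 : 0 ≤ (weight x - 0.9 * p * n) * (Real.log (1 - p) - Real.log p) :=
    mul_nonneg (by linarith) (by linarith)
  have h4 : 0 ≤ (n : ℝ) * (-Real.log (1 - p)) := mul_nonneg (Nat.cast_nonneg n) (by linarith)
  nlinarith

/-- The untruncated branch and the fresh uniform string each give a point mass at most `2^(-1.8m)`,
the latter because `n ≥ 6m`. The factor `2` for their sum fits in `2^(0.3m)` once `m ≥ 4`. -/
theorem le_minEntropy_shift_truncatedBiased {m : ℕ} {p : unitInterval} (h0 : 0 < (p : ℝ))
    (h1 : (p : ℝ) ≤ 1 / 2) (hn : 0 < n) (hH : binaryEntropy p = 2 * (m : ℝ) / n) (hm : 4 ≤ m)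
    (hmn : (m : ℝ) ≤ n / 6) (y : Bits n) :
    1.5 * (m : ℝ) ≤ minEntropy (shift y (truncatedBiased n p)) := by
  classical
  have hlog : 0 < Real.log 2 := Real.log_pos (by norm_num)
  have hn' : (0 : ℝ) < n := by exact_mod_cast hn
  have hm' : (4 : ℝ) ≤ m := by exact_mod_cast hm
  refine le_minEntropy _ fun u => ?_
  rw [toReal_eq_expectation, expectation_shift, expectation_truncatedBiased]
  set x₀ := add y u with hx₀
  have hadd : ∀ x, add y x = u ↔ x = x₀ := by
    intro x
    constructor
    · rintro rfl
      rw [hx₀, add_add_cancel]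
    · rintro rfl
      rw [hx₀, add_add_cancel]
  have hunif : (expectation (uniform n) fun x => if add y x = u then (1 : ℝ) else 0)
      = (1 / 2 : ℝ) ^ n := by
    rw [← uniform_toReal n x₀, toReal_eq_expectation]
    congr 1
    funext x
    exact if_congr (hadd x) rfl rfl
  rw [hunif]
  have hent : Real.exp (-(0.9 * n * Real.binEntropy p)) = (2 : ℝ) ^ (-(1.8 * (m : ℝ))) := by
    have : Real.binEntropy p = 2 * (m : ℝ) / n * Real.log 2 := by
      rw [← hH, binaryEntropy]
      field_simp
    rw [this, Real.rpow_def_of_pos (by norm_num)]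
    congr 1
    field_simp
    ring
  have hpow : (1 / 2 : ℝ) ^ n ≤ (2 : ℝ) ^ (-(1.8 * (m : ℝ))) := by
    have : (1 / 2 : ℝ) ^ n = (2 : ℝ) ^ (-(n : ℝ)) := by
      rw [Real.rpow_neg (by norm_num), Real.rpow_natCast]
      simp
    rw [this]
    exact Real.rpow_le_rpow_of_exponent_le (by norm_num) (by linarith)
  calc ∑ x, biasedWeight (p : ℝ) x * (if 0.9 * (p : ℝ) * n ≤ weight x then
        (if add y x = u then (1 : ℝ) else 0) else (1 / 2) ^ n)
      ≤ ∑ x, ((if add y x = u then (2 : ℝ) ^ (-(1.8 * (m : ℝ))) else 0)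
          + biasedWeight (p : ℝ) x * (1 / 2) ^ n) := by
        refine Finset.sum_le_sum fun x _ => ?_
        have hb := biasedWeight_nonneg p.2.1 p.2.2 x
        have hb2 : 0 ≤ biasedWeight (p : ℝ) x * (1 / 2 : ℝ) ^ n := by positivity
        have h2 : 0 < (2 : ℝ) ^ (-(1.8 * (m : ℝ))) := by positivity
        split_ifs with hw hx hx
        · have := biasedWeight_le_of_weight h0 h1 x hw
          linarith
        · linarith
        · linarith
        · linarith
    _ = (2 : ℝ) ^ (-(1.8 * (m : ℝ))) + (1 / 2) ^ n := by
        rw [Finset.sum_add_distrib, ← Finset.sum_mul, sum_biasedWeight]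
        simp [hadd]
    _ ≤ (2 : ℝ) ^ (1 : ℝ) * (2 : ℝ) ^ (-(1.8 * (m : ℝ))) := by
        rw [Real.rpow_one]
        linarith
    _ ≤ (2 : ℝ) ^ (-(1.5 * (m : ℝ))) := by
        rw [← Real.rpow_add (by norm_num)]
        exact Real.rpow_le_rpow_of_exponent_le (by norm_num) (by linarith)

end Distributions

end SparseExtractor
namespace SparseExtractor

/-! ### Estimates for the bias `p` and for the error terms. -/

section Parameters

theorem exists_binaryEntropy_eq {η : ℝ} (h0 : 0 ≤ η) (h1 : η ≤ 1) :
    ∃ p : unitInterval, (p : ℝ) ≤ 1 / 2 ∧ binaryEntropy p = η := by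
  have hlog : 0 < Real.log 2 := Real.log_pos (by norm_num)
  have hcont : ContinuousOn binaryEntropy (Set.Icc 0 (1 / 2)) :=
    (Real.binEntropy_continuous.div_const _).continuousOn
  have hmem : η ∈ Set.Icc (binaryEntropy 0) (binaryEntropy (1 / 2)) := by
    rw [binaryEntropy, binaryEntropy, Real.binEntropy_zero, zero_div, one_div,
      Real.binEntropy_two_inv, div_self hlog.ne']
    exact ⟨h0, h1⟩
  obtain ⟨p, hp, hpe⟩ := intermediate_value_Icc (by norm_num) hcont hmem
  exact ⟨⟨p, hp.1, hp.2.trans (by norm_num)⟩, hp.2, hpe⟩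

theorem mul_neg_log_le_binEntropy {p : ℝ} (h0 : 0 ≤ p) (h1 : p ≤ 1) :
    p * -Real.log p ≤ Real.binEntropy p := by
  rw [Real.binEntropy, Real.log_inv, Real.log_inv]
  have : 0 ≤ (1 - p) * -Real.log (1 - p) :=
    mul_nonneg (by linarith) (neg_nonneg.2 (Real.log_nonpos (by linarith) (by linarith)))
  linarith

/-- Apply `log u ≤ u - 1` at `u = 1/√p` and `u = 1/(1-p)`. This crude bound keeps `p` polynomially
large in `le_bias`. -/
theorem binEntropy_le_three_mul_sqrt {p : ℝ} (h0 : 0 < p) (h1 : p < 1) :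
    Real.binEntropy p ≤ 3 * √p := by
  have hs : 0 < √p := Real.sqrt_pos.2 h0
  have hsq : √p * √p = p := Real.mul_self_sqrt h0.le
  have hs1 : √p ≤ 1 := Real.sqrt_le_one.2 h1.le
  have e1 : p * Real.log p⁻¹ ≤ 2 * √p := by
    have h2 : Real.log p⁻¹ = 2 * Real.log (√p)⁻¹ := by
      rw [Real.log_inv, Real.log_inv, Real.log_sqrt h0.le]
      ring
    have h3 : Real.log (√p)⁻¹ ≤ (√p)⁻¹ - 1 := Real.log_le_sub_one_of_pos (inv_pos.2 hs)
    calc p * Real.log p⁻¹ ≤ p * (2 * (√p)⁻¹) := by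
          rw [h2]
          exact mul_le_mul_of_nonneg_left (by linarith) h0.le
      _ = √p * √p * (2 * (√p)⁻¹) := by rw [hsq]
      _ = 2 * √p := by field_simp
  have hq : 0 < 1 - p := by linarith
  have e2 : (1 - p) * Real.log (1 - p)⁻¹ ≤ √p := by
    calc (1 - p) * Real.log (1 - p)⁻¹ ≤ (1 - p) * ((1 - p)⁻¹ - 1) :=
          mul_le_mul_of_nonneg_left (Real.log_le_sub_one_of_pos (inv_pos.2 hq)) hq.le
      _ = p := by field_simp; ring
      _ ≤ √p := by nlinarith
  rw [Real.binEntropy]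
  linarith

theorem binEntropy_eq_of_binaryEntropy_eq {p η : ℝ} (hH : binaryEntropy p = η) :
    Real.binEntropy p = η * Real.log 2 := by
  have hlog : 0 < Real.log 2 := Real.log_pos (by norm_num)
  rw [← hH, binaryEntropy]
  field_simp

theorem log_twelve_le {x y : ℝ} (hx : 0 < x) (hxy : x ≤ y / 6) :
    Real.log 12 ≤ Real.log (2 * y / x) := by
  refine Real.log_le_log (by norm_num) ?_
  rw [le_div_iff₀ hx]
  linarith

/-- From `p ≤ H(p) = 2x/y` follows `log(1/p) ≥ log(2y/x) - log 4`. As `2y/x ≥ 12` and `4^5 ≤ 12^3`,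
at least `0.4 log(2y/x)` remains, and `p log(1/p) ≤ H(p) log 2` (natural logarithms) gives the
constant `2 / 0.4 = 5`. -/
theorem bias_mul_le {p x y : ℝ} (h0 : 0 < p) (h1 : p ≤ 1 / 2) (hx : 0 < x) (hxy : x ≤ y / 6)
    (hH : binaryEntropy p = 2 * x / y) : p * y * Real.log (2 * y / x) ≤ 5 * x * Real.log 2 := by
  have hlog : 0 < Real.log 2 := Real.log_pos (by norm_num)
  have hy : 0 < y := by linarith
  have hE := binEntropy_eq_of_binaryEntropy_eq hH
  have hle := mul_neg_log_le_binEntropy h0.le (by linarith)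
  rw [hE] at hle
  have hlp : Real.log 2 ≤ -Real.log p := by
    rw [← Real.log_inv]
    refine Real.log_le_log (by norm_num) ?_
    rw [le_inv_comm₀ (by norm_num) h0]
    linarith
  have hp2 : p ≤ 2 * x / y := by
    refine le_of_mul_le_mul_right ?_ hlog
    exact (mul_le_mul_of_nonneg_left hlp h0.le).trans hle
  have hlog4 : Real.log p ≤ Real.log 4 - Real.log (2 * y / x) := by
    rw [← Real.log_div (by norm_num) (by positivity)]
    refine Real.log_le_log h0 (hp2.trans (le_of_eq ?_))
    field_simp
    norm_num
  have h12 := log_twelve_le hx hxy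
  have h412 : 5 * Real.log 4 ≤ 3 * Real.log 12 := by
    have h2 := Real.log_le_log (by norm_num) (by norm_num : (4 : ℝ) ^ 5 ≤ 12 ^ 3)
    rw [Real.log_pow, Real.log_pow] at h2
    exact_mod_cast h2
  have h3 : 0.4 * Real.log (2 * y / x) ≤ -Real.log p := by linarith
  have h4 : p * (0.4 * Real.log (2 * y / x)) ≤ 2 * x / y * Real.log 2 :=
    (mul_le_mul_of_nonneg_left h3 h0.le).trans hle
  have h5 := mul_le_mul_of_nonneg_left h4 hy.le
  have h6 : y * (2 * x / y * Real.log 2) = 2 * x * Real.log 2 := by field_simp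
  rw [h6] at h5
  linarith

theorem bias_le_quarter {p x y : ℝ} (h0 : 0 < p) (h1 : p ≤ 1 / 2) (hx : 0 < x) (hxy : x ≤ y / 6)
    (hH : binaryEntropy p = 2 * x / y) : p ≤ 1 / 4 := by
  have hlog : 0 < Real.log 2 := Real.log_pos (by norm_num)
  have hy : 0 < y := by linarith
  have h2 := bias_mul_le h0 h1 hx hxy hH
  have h12 := log_twelve_le hx hxy
  have h122 : 10 * Real.log 2 ≤ 3 * Real.log 12 := by
    have h2 := Real.log_le_log (by norm_num) (by norm_num : (2 : ℝ) ^ 10 ≤ 12 ^ 3)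
    rw [Real.log_pow, Real.log_pow] at h2
    exact_mod_cast h2
  have h3 : p * y * (10 / 3 * Real.log 2) ≤ 5 * (y / 6) * Real.log 2 := by
    refine le_trans (mul_le_mul_of_nonneg_left (by linarith) (by positivity)) (h2.trans ?_)
    exact mul_le_mul_of_nonneg_right (by linarith) hlog.le
  have h4 : 0 < y * Real.log 2 := by positivity
  refine le_of_mul_le_mul_right ?_ h4
  linarith

theorem le_bias {p x y : ℝ} (h0 : 0 < p) (h1 : p ≤ 1 / 2) (hx : 0 < x) (hxy : x ≤ y / 6)
    (hH : binaryEntropy p = 2 * x / y) : 0.2 * (x / y) ^ 2 ≤ p := by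
  have hy : 0 < y := by linarith
  have hE := binEntropy_eq_of_binaryEntropy_eq hH
  have h2 := binEntropy_le_three_mul_sqrt h0 (by linarith)
  rw [hE] at h2
  have h3 : 0 < x / y := by positivity
  have h4 : 0.46 * (x / y) ≤ √p := by
    have := Real.log_two_gt_d9
    have h5 : 2 * (x / y) * 0.69 ≤ 2 * (x / y) * Real.log 2 :=
      mul_le_mul_of_nonneg_left (by linarith) (by positivity)
    have h6 : 2 * x / y = 2 * (x / y) := by ring
    rw [h6] at h2
    linarith
  have h7 := Real.sq_sqrt h0.le
  have h8 := pow_le_pow_left₀ (by positivity) h4 2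
  rw [h7] at h8
  have h9 := sq_nonneg (x / y)
  nlinarith

theorem eventually_large : ∃ m₀ : ℕ, ∀ m : ℕ, m₀ ≤ m →
    4 ≤ m ∧ (100 : ℝ) ≤ (m : ℝ) ^ (0.1 : ℝ) ∧ Real.logb 2 m ≤ (m : ℝ) ^ (0.01 : ℝ) := by
  have hlog : 0 < Real.log 2 := Real.log_pos (by norm_num)
  have hcast : Filter.Tendsto (fun m : ℕ => (m : ℝ)) Filter.atTop Filter.atTop :=
    tendsto_natCast_atTop_atTop
  have h1 := (tendsto_rpow_atTop (by norm_num : (0 : ℝ) < 0.1)).comp hcast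
  have h2 := hcast.eventually
    ((isLittleO_log_rpow_atTop (by norm_num : (0 : ℝ) < 0.01)).bound hlog)
  obtain ⟨m₀, hm₀⟩ := Filter.eventually_atTop.1
    ((Filter.eventually_ge_atTop 4).and ((h1.eventually_ge_atTop 100).and h2))
  refine ⟨m₀, fun m hm => ?_⟩
  obtain ⟨h4, h5, h6⟩ := hm₀ m hm
  refine ⟨h4, h5, ?_⟩
  rw [Real.logb, div_le_iff₀ hlog, mul_comm]
  refine (le_abs_self _).trans (h6.trans (le_of_eq ?_))
  rw [Real.norm_of_nonneg (by positivity)]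

/-- Here `x = m`, `y = n`, `D = x^0.5` and `t = x^0.98 / 8`. Up to constants the three exponents are
at least `x^0.42`, `x^0.94` and `x^0.96 - x^0.54`. Each exceeds `x^0.1 + 2`, where the `2` pays for
having three terms, as `e^2 ≥ 3`. -/
theorem exp_error_terms_le {x s p y : ℝ} (hx : 1 ≤ x) (hX : 100 ≤ x ^ (0.1 : ℝ)) (hs0 : 0 < s)
    (hs : s ≤ x ^ (1.04 : ℝ)) (hy : 0 < y) (hyx : y ≤ x ^ (1.02 : ℝ))
    (hp : 0.2 * (x / y) ^ 2 ≤ p) :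
    Real.exp (-((x ^ (0.98 : ℝ) / 8) ^ 2 / (2 * (x ^ (0.5 : ℝ) * s))))
        + Real.exp (-(p ^ 2 * y / 200))
        + (2 : ℝ) ^ (s / x ^ (0.5 : ℝ)) * Real.exp (-((x ^ (0.98 : ℝ) / 8) ^ 2 / (2 * x)))
      ≤ Real.exp (-(x ^ (0.1 : ℝ))) := by
  have hx0 : 0 < x := by linarith
  set X := x ^ (0.1 : ℝ) with hXdef
  have hXpow : ∀ k : ℕ, X ^ k = x ^ (0.1 * (k : ℝ)) := by
    intro k
    rw [hXdef, ← Real.rpow_natCast, ← Real.rpow_mul hx0.le]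
  have ht : (x ^ (0.98 : ℝ) / 8) ^ 2 = x ^ (1.96 : ℝ) / 64 := by
    rw [div_pow, ← Real.rpow_natCast, ← Real.rpow_mul hx0.le]
    norm_num
  have hmono : ∀ {a b : ℝ}, a ≤ b → x ^ a ≤ x ^ b :=
    fun hab => Real.rpow_le_rpow_of_exponent_le hx hab
  have b1 : X + 2 ≤ (x ^ (0.98 : ℝ) / 8) ^ 2 / (2 * (x ^ (0.5 : ℝ) * s)) := by
    have h1 : X ^ 4 ≤ x ^ (0.42 : ℝ) := by
      rw [hXpow]
      exact hmono (by norm_num)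
    have h2 : x ^ (0.5 : ℝ) * s ≤ x ^ (1.54 : ℝ) := by
      refine (mul_le_mul_of_nonneg_left hs (by positivity)).trans (le_of_eq ?_)
      rw [← Real.rpow_add hx0]
      norm_num
    have h3 : x ^ (1.96 : ℝ) = x ^ (0.42 : ℝ) * x ^ (1.54 : ℝ) := by
      rw [← Real.rpow_add hx0]
      norm_num
    have h4 : X + 2 ≤ X ^ 4 / 128 := by nlinarith [pow_le_pow_left₀ (by norm_num) hX 3]
    rw [ht, le_div_iff₀ (by positivity)]
    calc (X + 2) * (2 * (x ^ (0.5 : ℝ) * s)) ≤ x ^ (0.42 : ℝ) / 128 * (2 * x ^ (1.54 : ℝ)) := by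
          refine mul_le_mul (by linarith) (by linarith) (by positivity) (by positivity)
      _ = _ := by rw [h3]; ring
  have b2 : X + 2 ≤ p ^ 2 * y / 200 := by
    have h1 : X ^ 9 ≤ x ^ (0.94 : ℝ) := by
      rw [hXpow]
      exact hmono (by norm_num)
    have h2 : y ^ 3 ≤ x ^ (3.06 : ℝ) := by
      refine (pow_le_pow_left₀ hy.le hyx 3).trans (le_of_eq ?_)
      rw [← Real.rpow_natCast, ← Real.rpow_mul hx0.le]
      norm_num
    have h3 : x ^ 4 = x ^ (0.94 : ℝ) * x ^ (3.06 : ℝ) := by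
      rw [← Real.rpow_add hx0, ← Real.rpow_natCast]
      norm_num
    have h4 : (0.2 * (x / y) ^ 2) ^ 2 ≤ p ^ 2 := pow_le_pow_left₀ (by positivity) hp 2
    have h5 : x ^ (0.94 : ℝ) ≤ x ^ 4 / y ^ 3 := by
      rw [le_div_iff₀ (by positivity), h3]
      exact mul_le_mul_of_nonneg_left h2 (by positivity)
    have h6 : (0.2 * (x / y) ^ 2) ^ 2 * y = 0.04 * (x ^ 4 / y ^ 3) := by
      field_simp
      norm_num
    have h7 := mul_le_mul_of_nonneg_right h4 hy.le
    have h8 : X + 2 ≤ X ^ 9 / 5000 := by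
      have := pow_le_pow_left₀ (by norm_num) hX 8
      have h9 : X ^ 9 = X ^ 8 * X := by ring
      nlinarith
    linarith
  have b3 : X + 2 ≤ (x ^ (0.98 : ℝ) / 8) ^ 2 / (2 * x) - s / x ^ (0.5 : ℝ) := by
    have h1 : X ^ 9 ≤ x ^ (0.96 : ℝ) := by
      rw [hXpow]
      exact hmono (by norm_num)
    have h2 : s / x ^ (0.5 : ℝ) ≤ X ^ 6 := by
      rw [div_le_iff₀ (by positivity), hXpow, ← Real.rpow_add hx0]
      exact hs.trans (hmono (by norm_num))
    have h3 : (x ^ (0.98 : ℝ) / 8) ^ 2 / (2 * x) = x ^ (0.96 : ℝ) / 128 := by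
      have : x ^ (1.96 : ℝ) = x ^ (0.96 : ℝ) * x := by
        nth_rewrite 3 [← Real.rpow_one x]
        rw [← Real.rpow_add hx0]
        norm_num
      rw [ht, this]
      field_simp
      norm_num
    have h4 : X + 2 ≤ X ^ 9 / 128 - X ^ 6 := by
      have h5 := pow_le_pow_left₀ (by norm_num) hX 3
      have h6 := pow_le_pow_left₀ (by norm_num) hX 5
      have h7 : X ^ 9 = X ^ 6 * X ^ 3 := by ring
      have h8 : X ^ 6 = X ^ 5 * X := by ring
      have h9 : X ^ 6 * 100 ^ 3 ≤ X ^ 9 := by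
        rw [h7]
        exact mul_le_mul_of_nonneg_left h5 (by positivity)
      nlinarith
    rw [h3]
    linarith
  have hexp : ∀ b, X + 2 ≤ b → Real.exp (-b) ≤ Real.exp (-X) / 3 := by
    intro b hb
    have h3 : 3 ≤ Real.exp 2 := by linarith [Real.add_one_le_exp 2]
    rw [le_div_iff₀ (by norm_num)]
    calc Real.exp (-b) * 3 ≤ Real.exp (-b) * Real.exp 2 :=
          mul_le_mul_of_nonneg_left h3 (Real.exp_pos _).le
      _ = Real.exp (-b + 2) := (Real.exp_add _ _).symm
      _ ≤ Real.exp (-X) := Real.exp_le_exp.2 (by linarith)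
  have h2pow : (2 : ℝ) ^ (s / x ^ (0.5 : ℝ)) ≤ Real.exp (s / x ^ (0.5 : ℝ)) := by
    rw [Real.rpow_def_of_pos (by norm_num), Real.exp_le_exp]
    have := Real.log_two_lt_d9
    exact mul_le_of_le_one_left (by positivity) (by linarith)
  have e3 : (2 : ℝ) ^ (s / x ^ (0.5 : ℝ)) * Real.exp (-((x ^ (0.98 : ℝ) / 8) ^ 2 / (2 * x)))
      ≤ Real.exp (-X) / 3 := by
    refine (mul_le_mul_of_nonneg_right h2pow (Real.exp_pos _).le).trans ?_
    rw [← Real.exp_add]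
    refine le_trans (le_of_eq ?_) (hexp _ b3)
    congr 1
    ring
  linarith [hexp _ b1, hexp _ b2]

end Parameters

/-! ### Choice of parameters and assembly of the theorem. -/

/-- The mean error bound, at the parameters of the theorem. -/
theorem one_sub_exp_le_expectation_statDist {n m : ℕ} (hm : 4 ≤ m)
    (hX : (100 : ℝ) ≤ (m : ℝ) ^ (0.1 : ℝ)) (hlog : Real.logb 2 m ≤ (m : ℝ) ^ (0.01 : ℝ))
    (hnm : (n : ℝ) ^ (0.99 : ℝ) ≤ m) (hmn : (m : ℝ) ≤ n / 6) {p : unitInterval}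
    (h0 : 0 < (p : ℝ)) (h1 : (p : ℝ) ≤ 1 / 2) (hH : binaryEntropy p = 2 * (m : ℝ) / n)
    (h : Bits n → Bits m)
    (hs : IsSparse (0.001 * (n : ℝ) * Real.logb 2 m * Real.logb 2 (2 * (n : ℝ) / m)) h) :
    1 - Real.exp (-((m : ℝ) ^ (0.1 : ℝ)))
      ≤ expectation (shiftedTruncatedBiased n p) fun X => statDist (X.map h) (uniform m) := by
  have hm4 : (4 : ℝ) ≤ m := by exact_mod_cast hm
  have hm0 : (0 : ℝ) < m := by linarith
  have hn24 : (24 : ℝ) ≤ n := by linarith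
  have hn0 : (0 : ℝ) < n := by linarith
  have hlog2 : 0 < Real.log 2 := Real.log_pos (by norm_num)
  have hp4 := bias_le_quarter h0 h1 hm0 hmn hH
  have hpL := bias_mul_le h0 h1 hm0 hmn hH
  have hplow := le_bias h0 h1 hm0 hmn hH
  have hnle : (n : ℝ) ≤ (m : ℝ) ^ (1.02 : ℝ) := by
    calc (n : ℝ) = (n : ℝ) ^ (1 : ℝ) := (Real.rpow_one _).symm
      _ ≤ (n : ℝ) ^ (0.99 * 1.02 : ℝ) :=
          Real.rpow_le_rpow_of_exponent_le (by linarith) (by norm_num)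
      _ = ((n : ℝ) ^ (0.99 : ℝ)) ^ (1.02 : ℝ) := Real.rpow_mul hn0.le _ _
      _ ≤ _ := Real.rpow_le_rpow (by positivity) hnm (by norm_num)
  have hlm : 0 < Real.logb 2 m := Real.logb_pos (by norm_num) (by linarith)
  have hL12 : 1 < 2 * (n : ℝ) / m := by
    rw [lt_div_iff₀ hm0]
    linarith
  have hL0 : 0 < Real.logb 2 (2 * (n : ℝ) / m) := Real.logb_pos (by norm_num) hL12
  have hLle : Real.logb 2 (2 * (n : ℝ) / m) ≤ Real.logb 2 m := by
    refine Real.logb_le_logb_of_le (by norm_num) (by linarith) ?_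
    rw [div_le_iff₀ hm0]
    have e1 : (m : ℝ) ^ (0.1 : ℝ) * (m : ℝ) ^ (1.02 : ℝ) ≤ (m : ℝ) * m := by
      rw [← Real.rpow_add hm0, ← sq, ← Real.rpow_natCast]
      exact Real.rpow_le_rpow_of_exponent_le (by linarith) (by norm_num)
    have e2 : 2 * (n : ℝ) ≤ (m : ℝ) ^ (0.1 : ℝ) * (m : ℝ) ^ (1.02 : ℝ) :=
      mul_le_mul (by linarith) hnle hn0.le (by positivity)
    linarith
  set s := 0.001 * (n : ℝ) * Real.logb 2 m * Real.logb 2 (2 * (n : ℝ) / m) with hsdef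
  have hs0 : 0 < s := by positivity
  have hsle : s ≤ (m : ℝ) ^ (1.04 : ℝ) := by
    have e1 : (m : ℝ) ^ (1.04 : ℝ)
        = (m : ℝ) ^ (1.02 : ℝ) * (m : ℝ) ^ (0.01 : ℝ) * (m : ℝ) ^ (0.01 : ℝ) := by
      rw [← Real.rpow_add hm0, ← Real.rpow_add hm0]
      norm_num
    rw [e1, hsdef]
    gcongr
    · linarith
    · exact hLle.trans hlog
  -- The factor `0.004 = 4 * 0.001` times the `5` of `bias_mul_le` gives the loss `0.02 * log m` in
  -- the exponent.
  have hexp : (m : ℝ) ^ (0.98 : ℝ)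
      ≤ m * Real.exp (-(4 * Real.log 2 * p * (s / m))) := by
    have e1 : 4 * Real.log 2 * p * (s / m) ≤ 0.02 * Real.log m := by
      have e2 : 4 * Real.log 2 * p * (s / m)
          = 0.004 * (Real.log m / (m * Real.log 2)) * (p * n * Real.log (2 * (n : ℝ) / m)) := by
        rw [hsdef, Real.logb, Real.logb]
        field_simp
        ring
      have hlm' : 0 ≤ Real.log m := Real.log_nonneg (by linarith)
      rw [e2]
      refine (mul_le_mul_of_nonneg_left hpL (by positivity)).trans (le_of_eq ?_)
      field_simp
      ring
    calc (m : ℝ) ^ (0.98 : ℝ) = m * Real.exp (-(0.02 * Real.log m)) := by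
          nth_rewrite 2 [← Real.exp_log hm0]
          rw [← Real.exp_add, Real.rpow_def_of_pos hm0]
          congr 1
          ring
      _ ≤ _ := by
          refine mul_le_mul_of_nonneg_left (Real.exp_le_exp.2 (by linarith)) hm0.le
  have hpos : 0 < (m : ℝ) ^ (0.98 : ℝ) := by positivity
  -- With this `t`, `2t = m^0.98 / 4` is strictly below the mean excess, which is at least `m^0.98 /
  -- 2`.
  have main := one_sub_le_expectation_statDist (D := (m : ℝ) ^ (0.5 : ℝ))
    (t := (m : ℝ) ^ (0.98 : ℝ) / 8) (by exact_mod_cast hn0) hp4 (by omega) h hs hs0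
    (by positivity) (by positivity) (by linarith)
  have herr := exp_error_terms_le (by linarith) hX hs0 hsle hn0 hnle hplow
  linarith

end SparseExtractor

open SparseExtractor in
theorem theorem2 :
    ∃ c : ℝ, 0 < c ∧ ∃ m₀ : ℕ, ∀ n m : ℕ, m₀ ≤ m →
      (n : ℝ) ^ (0.99 : ℝ) ≤ (m : ℝ) → (m : ℝ) ≤ (n : ℝ) / 6 →
      (∃ D : PMF (PMF (Bits n)),
        (∃ p : unitInterval, (p : ℝ) ≤ 1 / 2 ∧ binaryEntropy p = 2 * (m : ℝ) / (n : ℝ) ∧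
          D = shiftedTruncatedBiased n p) ∧
        (∀ X ∈ D.support, 1.5 * (m : ℝ) ≤ minEntropy X) ∧
        ∀ h : Bits n → Bits m,
          IsSparse (0.001 * (n : ℝ) * Real.logb 2 m * Real.logb 2 (2 * (n : ℝ) / m)) h →
          1 - Real.exp (-((m : ℝ) ^ c)) ≤
            expectation D (fun X => statDist (X.map h) (uniform m))) ∧
      (∀ (ε : ℝ) (F : PMF (Bits n → Bits m)),
        IsStrongExtractorFamily (1.5 * (m : ℝ)) ε F →
        (F.toOuterMeasure
            {h | IsSparse (0.001 * (n : ℝ) * Real.logb 2 m * Real.logb 2 (2 * (n : ℝ) / m)) h}).toReal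
          * (1 - Real.exp (-((m : ℝ) ^ c))) ≤ ε) := by
  obtain ⟨m₀, hm₀⟩ := eventually_large
  -- The exponent `c = 0.1` is the one achieved by `exp_error_terms_le`.
  refine ⟨0.1, by norm_num, m₀, fun n m hm hnm hmn => ?_⟩
  obtain ⟨hm4, hX, hlog⟩ := hm₀ m hm
  have hm0 : (0 : ℝ) < m := by exact_mod_cast (by omega : 0 < m)
  have hn0 : (0 : ℝ) < n := by linarith
  obtain ⟨p, hp, hH⟩ := exists_binaryEntropy_eq (η := 2 * (m : ℝ) / n) (by positivity) (by
    rw [div_le_one hn0]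
    linarith)
  have h0 : 0 < (p : ℝ) := by
    refine lt_of_le_of_ne p.2.1 fun h => ?_
    rw [← h, binaryEntropy, Real.binEntropy_zero, zero_div] at hH
    have : 0 < 2 * (m : ℝ) / n := by positivity
    linarith
  have hmin : ∀ y, 1.5 * (m : ℝ) ≤ minEntropy (shift y (truncatedBiased n p)) :=
    le_minEntropy_shift_truncatedBiased h0 hp (by exact_mod_cast hn0) hH hm4 hmn
  have hdist := fun h hs => one_sub_exp_le_expectation_statDist hm4 hX hlog hnm hmn h0 hp hH h hs
  refine ⟨⟨_, ⟨p, hp, hH, rfl⟩, ?_, hdist⟩, fun ε F hF => ?_⟩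
  · intro X hXs
    rw [shiftedTruncatedBiased, PMF.mem_support_map_iff] at hXs
    obtain ⟨y, _, rfl⟩ := hXs
    exact hmin y
  · refine hF.prob_mul_le _ _ hmin fun h hs => ?_
    rw [← expectation_shiftedTruncatedBiased p fun X => statDist (X.map h) (uniform m)]
    exact hdist h hs
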